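/- **Conventions.** Fix $q\in\mathbb C\setminus\{0\}$, constants $\alpha_1,\alpha_2,\alpha_3\in\mathbb C$, and put $\nu_0=\alpha_1\alpha_2\alpha_3$. For $m\ge 1$ let $\mathcal T_m$ be the triangular arrangement of $m$ horizontal, $m$ vertical and $m$ diagonal lines of the triangular lattice drawn on $\mathbb Z^2$ (diagonals in direction $(1,-1)$), with vertices $(i,k)$, $i,k\ge1$, $i+k\le m+1$. Here $(i,k)$ is the crossing of the $i$-th horizontal line (counted from top to bottom) and the $k$-th vertical line (counted from right to left). It lies on the diagonal line number $i+k-1$ (diagonals are counted from top to bottom). The horizontal, diagonal and vertical lines carry arbitrary complex spectral parameters $z_1,\dots,z_m$, $t_1,\dots,t_m$, $w_1,\dots,w_m$, each with a chosen square root; $\sqrt{zw}$ means $\sqrt z\sqrt w$, and similarly for the other products. *Six-vertex weights.* Crossings of a horizontal and a vertical line (type 1), of a horizontal and a diagonal line (type 2), and of a diagonal and a vertical line (type 3) have weights $$\begin{aligned} a_1(z,w)&=\alpha_1(z-w), & b_1(z,w)&=\alpha_1(q^{-2}z-q^2w), & c_1(z,w)&=\alpha_1(q^2-q^{-2})\sqrt{zw},\\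 a_2(z,t)&=\alpha_2(qz-q^{-1}t), & b_2(z,t)&=\alpha_2(q^{-1}z-qt), & c_2(z,t)&=\alpha_2(q^2-q^{-2})\sqrt{zt},\\ a_3(t,w)&=\alpha_3(qt-q^{-1}w), & b_3(t,w)&=\alpha_3(q^{-1}t-qw), & c_3(t,w)&=\alpha_3(q^2-q^{-2})\sqrt{tw}. \end{aligned}$$ Every edge is oriented; it is said to carry a path step if it is oriented to the right, down, or down-right. A vertex of the six-vertex model (two arrows in, two out) has weight $a$ if none or all of its four edges carry a path step, $b$ if exactly one of its two lines carries path steps, on both of its edges at the vertex (a path goes straight), and $c$ otherwise (a path turns). *20V model.* A configuration of the 20V model is an orientation of all edges of $\mathcal T_m$, including the external ones, with three incoming and three outgoing edges at every vertex. With $z,t,w$ the parameters of the horizontal, diagonal and vertical lines through a vertex, the weight of the vertex is invariant under the reversal of all six arrows and equals $$\begin{aligned} \omega_0&=\nu_0(z-w)(qz-q^{-1}t)(qt-q^{-1}w) &&\text{no path step},\\ \omega_1&=\nu_0(q^{-2}z-q^2w)(qz-q^{-1}t)(q^{-1}t-qw) &&\text{one path, straight vertical},\\ \omega_2&=\nu_0(q^{-2}z-q^2w)(qz-q^{-1}t)(q^2-q^{-2})\sqrt{tw}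 &&\text{one path, turning between vertical and diagonal},\\ \omega_3&=\nu_0\,ztw(q^2-q^{-2})^3+\nu_0(z-w)(q^{-1}z-qt)(q^{-1}t-qw) &&\text{one path, straight diagonal},\\ \omega_4&=\nu_0(q^2-q^{-2})\sqrt{zw}(qz-q^{-1}t)(qt-q^{-1}w) &&\text{one path, turning between horizontal and vertical},\\ \omega_5&=\nu_0(q^{-2}z-q^2w)(q^2-q^{-2})\sqrt{zt}(qt-q^{-1}w) &&\text{one path, turning between horizontal and diagonal},\\ \omega_6&=\nu_0(q^{-2}z-q^2w)(q^{-1}z-qt)(qt-q^{-1}w) &&\text{one path, straight horizontal}. \end{aligned}$$ Equivalently, it is the sum, over the orientations of the three inner edges obtained when the diagonal line is moved slightly up, of the product of the three resulting six-vertex weights of types 1, 2, 3. *Boundary conditions.* In the boundary conditions DWBC3, all (vertical and diagonal) external edges on the North boundary point out, and all (horizontal and diagonal) external edges on the East boundary point in. At the vertices $(i,m+1-i)$ of the diagonal boundary, both the West and the South external edge point in if $2i<m+1$ and both point out if $2i>m+1$; if $2i=m+1$, the West edge points in and the South edge points out. $Z_m^{20V_3}[\mathbf z,\mathbf t,\mathbf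 w]$ is the sum over the 20V configurations with DWBC3 on $\mathcal T_m$ of the product of the weights of all vertices. *6V-DWBC.* $Z_n^{6V_1}[\mathbf z,\mathbf w]$ is the partition function of the six-vertex model on the $n\times n$ square formed by the horizontal lines $i=1,\dots,n$ and the vertical lines $j=1,\dots,n$, with weights $a_1,b_1,c_1$ evaluated at $(z_i,w_j)$ at the crossing of lines $i$ and $j$, and with external horizontal edges pointing in and external vertical edges pointing out. **Statement.** For all such $q,\alpha_1,\alpha_2,\alpha_3$, all spectral parameters $\mathbf z,\mathbf t,\mathbf w$ and all $n\ge1$ (so that $n=\lfloor\frac{m+1}2\rfloor$ for $m=2n$ and for $m=2n-1$), $$Z_{2n}^{20V_3}[\mathbf z,\mathbf t,\mathbf w]=\prod_{1\le i\le j\le 2n}a_2(z_i,t_j)\prod_{1\le k\le j\le 2n}a_3(t_j,w_k)\prod_{\substack{1\le i\le 2n+1-j\le n\ \text{or}\\ n+1\le i\le 2n+1-j\le 2n}}b_1(z_i,w_j)\; Z_n^{6V_1}[\mathbf z,\mathbf w],$$ $$Z_{2n-1}^{20V_3}[\mathbf z,\mathbf t,\mathbf w]=\prod_{1\le i\le j\le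 2n-1}a_2(z_i,t_j)\prod_{1\le k\le j\le 2n-1}a_3(t_j,w_k)\prod_{\substack{1\le i\le 2n-j\le n-1\ \text{or}\\ n+1\le i\le 2n-j\le 2n-1}}b_1(z_i,w_j)\; Z_n^{6V_1}[\mathbf z,\mathbf w].$$ -/

import Mathlib

namespace TwentyVertex

/-! ### Spectral parameters and integrable six-vertex weights -/

/-- A complex spectral parameter together with a choice of square root; the expression `√(z w)` in
the weights is read as `√z * √w`.  Every complex number underlies such a parameter. -/
structure Spectral where
  val : ℂ
  root : ℂ
  root_sq : root ^ 2 = val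

instance : Coe Spectral ℂ := ⟨Spectral.val⟩

/-- Sublattice 1: a horizontal line (parameter `z`) crosses a vertical line (parameter `w`). -/
noncomputable def a₁ (α _q : ℂ) (z w : Spectral) : ℂ := α * ((z : ℂ) - w)

noncomputable def b₁ (α q : ℂ) (z w : Spectral) : ℂ := α * ((q ^ 2)⁻¹ * z - q ^ 2 * w)

noncomputable def c₁ (α q : ℂ) (z w : Spectral) : ℂ := α * (q ^ 2 - (q ^ 2)⁻¹) * (z.root * w.root)

/-- Sublattice 2: a horizontal line (parameter `z`) crosses a diagonal line (parameter `t`). -/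
noncomputable def a₂ (α q : ℂ) (z t : Spectral) : ℂ := α * (q * z - q⁻¹ * t)

noncomputable def b₂ (α q : ℂ) (z t : Spectral) : ℂ := α * (q⁻¹ * z - q * t)

noncomputable def c₂ (α q : ℂ) (z t : Spectral) : ℂ := α * (q ^ 2 - (q ^ 2)⁻¹) * (z.root * t.root)

/-- Sublattice 3: a diagonal line (parameter `t`) crosses a vertical line (parameter `w`). -/
noncomputable def a₃ (α q : ℂ) (t w : Spectral) : ℂ := α * (q * t - q⁻¹ * w)

noncomputable def b₃ (α q : ℂ) (t w : Spectral) : ℂ := α * (q⁻¹ * t - q * w)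

noncomputable def c₃ (α q : ℂ) (t w : Spectral) : ℂ := α * (q ^ 2 - (q ^ 2)⁻¹) * (t.root * w.root)

/-- The weight of a vertex of the six-vertex model at the crossing of two lines.  Each of the four
edges is `true` when it is oriented along the direction of its line (right, down, or down-right),
that is, when it carries a path step, and `false` when it is oriented in the opposite direction.
The edges of the first line before and after the crossing are `x`, `x'`, those of the second line
are `y`, `y'`.  Empty and full vertices are of type `a`, vertices where one path goes straight are
of type `b`, vertices where one path turns are of type `c`. -/
def weight6V (a b c : ℂ) : (x y x' y' : Bool) → ℂ
  | false, false, false, false => a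
  | true,  true,  true,  true  => a
  | true,  false, true,  false => b
  | false, true,  false, true  => b
  | true,  false, false, true  => c
  | false, true,  true,  false => c
  | _, _, _, _ => 0

/-! ### Integrable twenty-vertex weights -/

section Omega

variable (ν₀ q : ℂ) (z t w : Spectral)

noncomputable def ω₀ : ℂ := ν₀ * ((z : ℂ) - w) * (q * z - q⁻¹ * t) * (q * t - q⁻¹ * w)

noncomputable def ω₁ : ℂ := ν₀ * ((q ^ 2)⁻¹ * z - q ^ 2 * w) * (q * z - q⁻¹ * t) * (q⁻¹ * t - q * w)

noncomputable def ω₂ : ℂ :=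
  ν₀ * ((q ^ 2)⁻¹ * z - q ^ 2 * w) * (q * z - q⁻¹ * t) * (q ^ 2 - (q ^ 2)⁻¹) * (t.root * w.root)

noncomputable def ω₃ : ℂ :=
  ν₀ * ((z : ℂ) * t * w) * (q ^ 2 - (q ^ 2)⁻¹) ^ 3
    + ν₀ * ((z : ℂ) - w) * (q⁻¹ * z - q * t) * (q⁻¹ * t - q * w)

noncomputable def ω₄ : ℂ :=
  ν₀ * (q ^ 2 - (q ^ 2)⁻¹) * (z.root * w.root) * (q * z - q⁻¹ * t) * (q * t - q⁻¹ * w)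

noncomputable def ω₅ : ℂ :=
  ν₀ * ((q ^ 2)⁻¹ * z - q ^ 2 * w) * (q ^ 2 - (q ^ 2)⁻¹) * (z.root * t.root) * (q * t - q⁻¹ * w)

noncomputable def ω₆ : ℂ := ν₀ * ((q ^ 2)⁻¹ * z - q ^ 2 * w) * (q⁻¹ * z - q * t) * (q * t - q⁻¹ * w)

/-- The weight of a vertex of the twenty-vertex model.  The arguments are the West, North and
North-West edges, then the East, South and South-East edges; an edge is `true` when it is oriented
to the right, down, or down-right (it carries a path step), and `false` when it is oriented to the
left, up, or up-left.  In every class, the second half of the list consists of the configurations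
obtained from the first half by reversing all arrows. -/
noncomputable def weight20V : (W N NW E S SE : Bool) → ℂ
  -- empty, full
  | false, false, false, false, false, false => ω₀ ν₀ q z t w
  | true,  true,  true,  true,  true,  true  => ω₀ ν₀ q z t w
  -- a straight vertical path
  | false, true,  false, false, true,  false => ω₁ ν₀ q z t w
  | true,  false, true,  true,  false, true  => ω₁ ν₀ q z t w
  -- a turn between a vertical and a diagonal edge
  | false, true,  false, false, false, true  => ω₂ ν₀ q z t w
  | false, false, true,  false, true,  false => ω₂ ν₀ q z t w
  | true,  false, true,  true,  true,  false => ω₂ ν₀ q z t w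
  | true,  true,  false, true,  false, true  => ω₂ ν₀ q z t w
  -- a straight diagonal path
  | false, false, true,  false, false, true  => ω₃ ν₀ q z t w
  | true,  true,  false, true,  true,  false => ω₃ ν₀ q z t w
  -- a turn between a horizontal and a vertical edge
  | true,  false, false, false, true,  false => ω₄ ν₀ q z t w
  | false, true,  false, true,  false, false => ω₄ ν₀ q z t w
  | false, true,  true,  true,  false, true  => ω₄ ν₀ q z t w
  | true,  false, true,  false, true,  true  => ω₄ ν₀ q z t w
  -- a turn between a horizontal and a diagonal edge
  | true,  false, false, false, false, true  => ω₅ ν₀ q z t w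
  | false, false, true,  true,  false, false => ω₅ ν₀ q z t w
  | false, true,  true,  true,  true,  false => ω₅ ν₀ q z t w
  | true,  true,  false, false, true,  true  => ω₅ ν₀ q z t w
  -- a straight horizontal path
  | true,  false, false, true,  false, false => ω₆ ν₀ q z t w
  | false, true,  true,  false, true,  true  => ω₆ ν₀ q z t w
  -- not an ice configuration
  | _, _, _, _, _, _ => 0

end Omega

set_option maxHeartbeats 4000000 in
/-- The table of twenty-vertex weights agrees with their construction from the Kagome lattice: the
diagonal line is moved slightly up, and the product of the three six-vertex weights is summed over
the orientations `x`, `y`, `d` of the horizontal, vertical and diagonal inner edges. -/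
theorem weight20V_eq_kagome (α₁ α₂ α₃ q : ℂ) (hq : q ≠ 0) (z t w : Spectral)
    (W N NW E S SE : Bool) :
    weight20V (α₁ * α₂ * α₃) q z t w W N NW E S SE =
      ∑ x : Bool, ∑ y : Bool, ∑ d : Bool,
        weight6V (a₁ α₁ q z w) (b₁ α₁ q z w) (c₁ α₁ q z w) W y x S *
        weight6V (a₂ α₂ q z t) (b₂ α₂ q z t) (c₂ α₂ q z t) x d E SE *
        weight6V (a₃ α₃ q t w) (b₃ α₃ q t w) (c₃ α₃ q t w) NW N d y := by
  obtain ⟨z, sz, rfl⟩ := z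
  obtain ⟨t, st, rfl⟩ := t
  obtain ⟨w, sw, rfl⟩ := w
  cases W <;> cases N <;> cases NW <;> cases E <;> cases S <;> cases SE <;>
    simp [weight20V, weight6V, ω₀, ω₁, ω₂, ω₃, ω₄, ω₅, ω₆,
      a₁, b₁, c₁, a₂, b₂, c₂, a₃, b₃, c₃] <;>
    (try ring1) <;> field_simp <;> ring

/-! ### Configurations

Horizontal lines are numbered from top to bottom, vertical lines from right to left, diagonal lines
(in the direction `(1, -1)`) from top to bottom, starting at `1`.  The vertex `(i, k)` is the
crossing of the `i`-th horizontal and the `k`-th vertical line; it lies on the diagonal line number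
`i + k - 1`. -/

/-- Edges of the lattice.
`h i k` is the edge on the horizontal line `i` to the East of the vertex `(i, k)`, so that
`h i (k + 1)` is the edge to its West.
`v k i` is the edge on the vertical line `k` to the North of the vertex `(i, k)`, so that
`v k (i + 1)` is the edge to its South.
`d j i` is the edge on the diagonal line `j` to the North-West of the vertex of this line in row
`i`, so that `d j (i + 1)` is the edge to its South-East. -/
inductive Edge where
  | h (i k : ℕ)
  | v (k i : ℕ)
  | d (j i : ℕ)
deriving DecidableEq

/-- An orientation of the edges is recorded by the finite set `S` of the edges that carry a path
step: those oriented to the right, down, or down-right. -/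
def occ (S : Finset Edge) (e : Edge) : Bool := decide (e ∈ S)

/-- The vertices of the triangle of size `m`. -/
def vertices20V (m : ℕ) : Finset (ℕ × ℕ) :=
  (Finset.Icc 1 m ×ˢ Finset.Icc 1 m).filter fun p => p.1 + p.2 ≤ m + 1

/-- All edges, inner and external, of the triangle of size `m`: the six edges around its
vertices. -/
def edges20V (m : ℕ) : Finset Edge :=
  (vertices20V m).biUnion fun p =>
    {Edge.h p.1 (p.2 + 1), Edge.v p.2 p.1, Edge.d (p.1 + p.2 - 1) p.1,
     Edge.h p.1 p.2, Edge.v p.2 (p.1 + 1), Edge.d (p.1 + p.2 - 1) (p.1 + 1)}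

/-- The ice rule at the vertex `(i, k)`: three edges are incoming (hence three are outgoing). -/
def Ice20V (S : Finset Edge) (i k : ℕ) : Prop :=
  (occ S (.h i (k + 1))).toNat + (occ S (.v k i)).toNat + (occ S (.d (i + k - 1) i)).toNat
    + (!occ S (.h i k)).toNat + (!occ S (.v k (i + 1))).toNat
    + (!occ S (.d (i + k - 1) (i + 1))).toNat = 3

/-- Domain-wall boundary conditions DWBC3 on the triangle of size `m`. -/
structure DWBC3 (m : ℕ) (S : Finset Edge) : Prop where
  /-- External edges on the North boundary (vertical and diagonal) point out. -/
  north_v : ∀ k ∈ Finset.Icc 1 m, Edge.v k 1 ∉ S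
  north_d : ∀ j ∈ Finset.Icc 1 m, Edge.d j 1 ∉ S
  /-- External edges on the East boundary (horizontal and diagonal) point in. -/
  east_h : ∀ i ∈ Finset.Icc 1 m, Edge.h i 1 ∉ S
  east_d : ∀ j ∈ Finset.Icc 1 m, Edge.d j (j + 1) ∉ S
  /-- In the top half of the diagonal boundary, the West and South external edges of the vertex
  `(i, m + 1 - i)` point in. -/
  diag_top : ∀ i ∈ Finset.Icc 1 m, 2 * i < m + 1 →
    Edge.h i (m + 2 - i) ∈ S ∧ Edge.v (m + 1 - i) (i + 1) ∉ S
  /-- In the bottom half they point out. -/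
  diag_bottom : ∀ i ∈ Finset.Icc 1 m, m + 1 < 2 * i →
    Edge.h i (m + 2 - i) ∉ S ∧ Edge.v (m + 1 - i) (i + 1) ∈ S
  /-- At the central vertex (for odd `m`) the West edge points in and the South edge points out. -/
  diag_center : ∀ i ∈ Finset.Icc 1 m, 2 * i = m + 1 →
    Edge.h i (m + 2 - i) ∈ S ∧ Edge.v (m + 1 - i) (i + 1) ∈ S

open Classical in
/-- The configurations of the twenty-vertex model with DWBC3 on the triangle of size `m`. -/
noncomputable def configs20V₃ (m : ℕ) : Finset (Finset Edge) :=
  (edges20V m).powerset.filter fun S => DWBC3 m S ∧ ∀ p ∈ vertices20V m, Ice20V S p.1 p.2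

/-- The inhomogeneous partition function of the twenty-vertex model with DWBC3 on the triangle of
size `m`. -/
noncomputable def Z20V₃ (ν₀ q : ℂ) (m : ℕ) (z t w : ℕ → Spectral) : ℂ :=
  ∑ S ∈ configs20V₃ m, ∏ p ∈ vertices20V m,
    weight20V ν₀ q (z p.1) (t (p.1 + p.2 - 1)) (w p.2)
      (occ S (.h p.1 (p.2 + 1))) (occ S (.v p.2 p.1)) (occ S (.d (p.1 + p.2 - 1) p.1))
      (occ S (.h p.1 p.2)) (occ S (.v p.2 (p.1 + 1))) (occ S (.d (p.1 + p.2 - 1) (p.1 + 1)))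

/-- The vertices of the `n × n` square. -/
def vertices6V (n : ℕ) : Finset (ℕ × ℕ) := Finset.Icc 1 n ×ˢ Finset.Icc 1 n

/-- All edges, inner and external, of the `n × n` square: the four edges around its vertices. -/
def edges6V (n : ℕ) : Finset Edge :=
  (vertices6V n).biUnion fun p =>
    {Edge.h p.1 (p.2 + 1), Edge.v p.2 p.1, Edge.h p.1 p.2, Edge.v p.2 (p.1 + 1)}

/-- The ice rule at the vertex `(i, k)` of the square: two edges are incoming. -/
def Ice6V (S : Finset Edge) (i k : ℕ) : Prop :=
  (occ S (.h i (k + 1))).toNat + (occ S (.v k i)).toNat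
    + (!occ S (.h i k)).toNat + (!occ S (.v k (i + 1))).toNat = 2

/-- Domain-wall boundary conditions on the square: external horizontal edges point in, external
vertical edges point out. -/
structure DWBC (n : ℕ) (S : Finset Edge) : Prop where
  north : ∀ k ∈ Finset.Icc 1 n, Edge.v k 1 ∉ S
  south : ∀ k ∈ Finset.Icc 1 n, Edge.v k (n + 1) ∈ S
  east : ∀ i ∈ Finset.Icc 1 n, Edge.h i 1 ∉ S
  west : ∀ i ∈ Finset.Icc 1 n, Edge.h i (n + 1) ∈ S

open Classical in
/-- The configurations of the six-vertex model with DWBC on the `n × n` square. -/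
noncomputable def configs6V (n : ℕ) : Finset (Finset Edge) :=
  (edges6V n).powerset.filter fun S => DWBC n S ∧ ∀ p ∈ vertices6V n, Ice6V S p.1 p.2

/-- The inhomogeneous partition function of the six-vertex model with DWBC on the `n × n` square,
with the weights of sublattice 1. -/
noncomputable def Z6V₁ (α₁ q : ℂ) (n : ℕ) (z w : ℕ → Spectral) : ℂ :=
  ∑ S ∈ configs6V n, ∏ p ∈ vertices6V n,
    weight6V (a₁ α₁ q (z p.1) (w p.2)) (b₁ α₁ q (z p.1) (w p.2)) (c₁ α₁ q (z p.1) (w p.2))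
      (occ S (.h p.1 (p.2 + 1))) (occ S (.v p.2 p.1))
      (occ S (.h p.1 p.2)) (occ S (.v p.2 (p.1 + 1)))

end TwentyVertex

open TwentyVertex

namespace TwentyVertex

/-! The lines are followed away from the North-East boundary: horizontal ones to the West, vertical
ones to the South, diagonal ones to the South-East. The partition function of a region becomes a
function of the states in which the lines leave it (`configSum`), and attaching a vertex at the
outer corner applies a local operator on the lines through that vertex. The rightmost factor of a
product of operators acts first.

The operator of a twenty-vertex crossing factors both as `R₁ * R₂ * R₃` and as `R₃ * R₂ * R₁`,
according to the side to which the diagonal line is pushed. Equality of the two products is the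
Yang-Baxter equation; no weight is divided out, so no genericity of the parameters is needed.

In the last layer of the triangle all crossings of the diagonal line can be performed before those
of type 1 (`layer_R20V`). The Yang-Baxter equation then moves this line North-East across the inner
layers, one at a time (`diagonal_mul_layer`). Each move exposes a crossing with a vertical line and
one with a horizontal line that the remaining triangle does not meet. By conservation of paths and
the emptiness of the external diagonal edges, both crossings are empty and give factors `a₃` and
`a₂` (`agreeOn_diagonal_triangle6V`). Once all diagonal lines are removed (`agreeOn_triangle_R20V`),
a six-vertex model with weights of type 1 is left on the triangle.

Its exit states are full on the first `n` horizontal and the first `n` vertical lines and empty on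
the others. At a vertex of the triangle outside the `n × n` square exactly one of the two lines is
full, which forces weight `b₁`. Peeling off these vertices (`configSum_domainWall`) leaves the
square with domain wall boundary conditions. -/

open Function

/-! ### Local operators attached to crossings of lines. -/

/-- The lines of the lattice. -/
inductive Line where
  | h (i : ℕ)
  | v (k : ℕ)
  | d (j : ℕ)
deriving DecidableEq

/-- The operators on functions of the occupation numbers of the lines. -/
abbrev Op := Module.End ℂ ((Line → Bool) → ℂ)

/-- The crossing of the lines `a` and `b`, with weight `W` depending on the states of `a` and `b`
before and after the crossing. -/
def crossing (W : Bool → Bool → Bool → Bool → ℂ) (a b : Line) : Op where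
  toFun f s := ∑ x, ∑ y, W x y (s a) (s b) * f (update (update s a x) b y)
  map_add' f g := by
    funext s
    simp only [Pi.add_apply, mul_add, Finset.sum_add_distrib]
  map_smul' r f := by
    funext s
    simp only [Pi.smul_apply, smul_eq_mul, RingHom.id_apply, Finset.mul_sum]
    exact Finset.sum_congr rfl fun _ _ => Finset.sum_congr rfl fun _ _ => by ring

/-- The simultaneous crossing of the lines `a`, `b` and `c`. -/
def tripleCrossing (W : Bool → Bool → Bool → Bool → Bool → Bool → ℂ) (a b c : Line) : Op where
  toFun f s := ∑ x, ∑ y, ∑ z, W x y z (s a) (s b) (s c) *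
    f (update (update (update s a x) b y) c z)
  map_add' f g := by
    funext s
    simp only [Pi.add_apply, mul_add, Finset.sum_add_distrib]
  map_smul' r f := by
    funext s
    simp only [Pi.smul_apply, smul_eq_mul, RingHom.id_apply, Finset.mul_sum]
    exact Finset.sum_congr rfl fun _ _ => Finset.sum_congr rfl fun _ _ =>
      Finset.sum_congr rfl fun _ _ => by ring

theorem crossing_apply (W : Bool → Bool → Bool → Bool → ℂ) (a b : Line)
    (f : (Line → Bool) → ℂ) (s : Line → Bool) :
    crossing W a b f s = ∑ x, ∑ y, W x y (s a) (s b) * f (update (update s a x) b y) := rfl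

theorem tripleCrossing_apply (W : Bool → Bool → Bool → Bool → Bool → Bool → ℂ) (a b c : Line)
    (f : (Line → Bool) → ℂ) (s : Line → Bool) :
    tripleCrossing W a b c f s = ∑ x, ∑ y, ∑ z, W x y z (s a) (s b) (s c) *
      f (update (update (update s a x) b y) c z) := rfl

theorem commute_crossing (W W' : Bool → Bool → Bool → Bool → ℂ) {a b a' b' : Line}
    (h₁ : a ≠ a') (h₂ : a ≠ b') (h₃ : b ≠ a') (h₄ : b ≠ b') :
    Commute (crossing W a b) (crossing W' a' b') := by
  refine LinearMap.ext fun f => funext fun s => ?_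
  have key (x y x' y' : Bool) : update (update (update (update s a x) b y) a' x') b' y' =
      update (update (update (update s a' x') b' y') a x) b y := by
    rw [update_comm h₃, update_comm h₁, update_comm h₄, update_comm h₂]
  simp only [Module.End.mul_apply, crossing_apply, update_of_ne h₁, update_of_ne h₂,
    update_of_ne h₃, update_of_ne h₄, update_of_ne h₁.symm, update_of_ne h₂.symm,
    update_of_ne h₃.symm, update_of_ne h₄.symm, key, Fintype.sum_bool]
  ring

/-- For `a` horizontal, `b` vertical and `c` diagonal, the diagonal line meets the other two before
they meet each other, so it passes to the North-East of their crossing. The summation variables `p`,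
`r`, `u` are the inner edges of `a`, `b`, `c`. -/
theorem crossing_mul_ac_bc_ab (U V W : Bool → Bool → Bool → Bool → ℂ) {a b c : Line}
    (hab : a ≠ b) (hac : a ≠ c) (hbc : b ≠ c) :
    crossing U a b * crossing V a c * crossing W c b =
      tripleCrossing (fun x y z x' y' z' => ∑ p, ∑ r, ∑ u,
        U p r x' y' * V x u p z' * W z y u r) a b c := by
  refine LinearMap.ext fun f => funext fun s => ?_
  have key (p r x u z y : Bool) :
      update (update (update (update (update (update s a p) b r) a x) c u) c z) b y =
        update (update (update s a x) b y) c z := by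
    rw [update_idem, update_comm hab.symm, update_idem, update_comm hbc.symm, update_idem]
  simp only [Module.End.mul_apply, crossing_apply, tripleCrossing_apply, key, update_self,
    update_of_ne hab, update_of_ne hbc, update_of_ne hab.symm,
    update_of_ne hac.symm, update_of_ne hbc.symm, Fintype.sum_bool]
  ring

/-- The opposite resolution: `a` and `b` cross first, so `c` passes on the other side of their
crossing. -/
theorem crossing_mul_bc_ac_ab (U V W : Bool → Bool → Bool → Bool → ℂ) {a b c : Line}
    (hab : a ≠ b) (hac : a ≠ c) (hbc : b ≠ c) :
    crossing W c b * crossing V a c * crossing U a b =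
      tripleCrossing (fun x y z x' y' z' => ∑ p, ∑ r, ∑ u,
        W u r z' y' * V p z x' u * U x y p r) a b c := by
  refine LinearMap.ext fun f => funext fun s => ?_
  have key (u r p z x y : Bool) :
      update (update (update (update (update (update s c u) b r) a p) c z) a x) b y =
        update (update (update s a x) b y) c z := by
    funext l
    simp only [update_apply]
    split_ifs <;> first | rfl | simp_all
  simp only [Module.End.mul_apply, crossing_apply, tripleCrossing_apply, key, update_self,
    update_of_ne hab, update_of_ne hac, update_of_ne hbc, update_of_ne hab.symm,
    update_of_ne hbc.symm, Fintype.sum_bool]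
  ring

set_option maxHeartbeats 4000000 in
/-- The table of twenty-vertex weights, when the diagonal line is moved slightly down. -/
theorem weight20V_eq_kagome_down (α₁ α₂ α₃ q : ℂ) (hq : q ≠ 0) (z t w : Spectral)
    (W N NW E S SE : Bool) :
    weight20V (α₁ * α₂ * α₃) q z t w W N NW E S SE =
      ∑ p : Bool, ∑ r : Bool, ∑ u : Bool,
        weight6V (a₃ α₃ q t w) (b₃ α₃ q t w) (c₃ α₃ q t w) u r SE S *
        weight6V (a₂ α₂ q z t) (b₂ α₂ q z t) (c₂ α₂ q z t) W NW p u *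
        weight6V (a₁ α₁ q z w) (b₁ α₁ q z w) (c₁ α₁ q z w) p N E r := by
  obtain ⟨z, sz, rfl⟩ := z
  obtain ⟨t, st, rfl⟩ := t
  obtain ⟨w, sw, rfl⟩ := w
  cases W <;> cases N <;> cases NW <;> cases E <;> cases S <;> cases SE <;>
    simp [weight20V, weight6V, ω₀, ω₁, ω₂, ω₃, ω₄, ω₅, ω₆,
      a₁, b₁, c₁, a₂, b₂, c₂, a₃, b₃, c₃] <;>
    (try ring1) <;> field_simp <;> ring

/-! ### Crossings of the six-vertex and of the twenty-vertex model -/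

/-- The crossing of a horizontal line, read from East to West, with another line. -/
noncomputable def crossingWest (a b c : ℂ) : Line → Line → Op :=
  crossing fun x y x' y' => weight6V a b c x' y x y'

noncomputable def R₁ (α q : ℂ) (z w : ℕ → Spectral) (i k : ℕ) : Op :=
  crossingWest (a₁ α q (z i) (w k)) (b₁ α q (z i) (w k)) (c₁ α q (z i) (w k)) (.h i) (.v k)

noncomputable def R₂ (α q : ℂ) (z : ℕ → Spectral) (t : Spectral) (i j : ℕ) : Op :=
  crossingWest (a₂ α q (z i) t) (b₂ α q (z i) t) (c₂ α q (z i) t) (.h i) (.d j)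

noncomputable def R₃ (α q : ℂ) (w : ℕ → Spectral) (t : Spectral) (j k : ℕ) : Op :=
  crossing (weight6V (a₃ α q t (w k)) (b₃ α q t (w k)) (c₃ α q t (w k))) (.d j) (.v k)

noncomputable def R20V (ν q : ℂ) (z w : ℕ → Spectral) (t : Spectral) (i k j : ℕ) : Op :=
  tripleCrossing (fun x y u x' y' u' => weight20V ν q (z i) t (w k) x' y u x y' u')
    (.h i) (.v k) (.d j)

/-- The Kagome form of the weights, read with the horizontal line running West; this is why its two
states `x` and `x'` change places in the weight. -/
theorem R20V_eq_R₁_mul_R₂_mul_R₃ (α₁ α₂ α₃ q : ℂ) (hq : q ≠ 0) (z w : ℕ → Spectral)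
    (t : Spectral) (i k j : ℕ) :
    R20V (α₁ * α₂ * α₃) q z w t i k j = R₁ α₁ q z w i k * R₂ α₂ q z t i j * R₃ α₃ q w t j k := by
  rw [R₁, R₂, R₃, crossingWest, crossingWest,
    crossing_mul_ac_bc_ab _ _ _ (by simp) (by simp) (by simp), R20V]
  congr 1
  funext x y u x' y' u'
  exact weight20V_eq_kagome α₁ α₂ α₃ q hq (z i) t (w k) x' y u x y' u'

theorem R20V_eq_R₃_mul_R₂_mul_R₁ (α₁ α₂ α₃ q : ℂ) (hq : q ≠ 0) (z w : ℕ → Spectral)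
    (t : Spectral) (i k j : ℕ) :
    R20V (α₁ * α₂ * α₃) q z w t i k j = R₃ α₃ q w t j k * R₂ α₂ q z t i j * R₁ α₁ q z w i k := by
  rw [R₁, R₂, R₃, crossingWest, crossingWest,
    crossing_mul_bc_ac_ab _ _ _ (by simp) (by simp) (by simp), R20V]
  congr 1
  funext x y u x' y' u'
  exact weight20V_eq_kagome_down α₁ α₂ α₃ q hq (z i) t (w k) x' y u x y' u'

/-- The Yang-Baxter equation, normalised so that no weight has to be cancelled. -/
theorem yang_baxter (α₁ α₂ α₃ q : ℂ) (hq : q ≠ 0) (z w : ℕ → Spectral)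
    (t : Spectral) (i k j : ℕ) :
    R₃ α₃ q w t j k * R₂ α₂ q z t i j * R₁ α₁ q z w i k =
      R₁ α₁ q z w i k * R₂ α₂ q z t i j * R₃ α₃ q w t j k := by
  rw [← R20V_eq_R₃_mul_R₂_mul_R₁ α₁ α₂ α₃ q hq, R20V_eq_R₁_mul_R₂_mul_R₃ α₁ α₂ α₃ q hq]

/-! ### Functions that vanish, or agree, according to the states of some lines -/

/-- The function `f` vanishes when the line `l` carries a path step. -/
def EmptyOn (l : Line) (f : (Line → Bool) → ℂ) : Prop := ∀ s, s l = true → f s = 0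

theorem EmptyOn.crossing {l a b : Line} {f : (Line → Bool) → ℂ} (hf : EmptyOn l f)
    (ha : l ≠ a) (hb : l ≠ b) (W : Bool → Bool → Bool → Bool → ℂ) :
    EmptyOn l (crossing W a b f) := by
  intro s hs
  rw [crossing_apply]
  refine Finset.sum_eq_zero fun x _ => Finset.sum_eq_zero fun y _ => ?_
  rw [hf _ (by rwa [update_of_ne hb, update_of_ne ha]), mul_zero]

/-- The functions `f` and `g` agree when the lines of `A` carry no path step. -/
def AgreeOn (A : Set Line) (f g : (Line → Bool) → ℂ) : Prop :=
  ∀ s, (∀ l ∈ A, s l = false) → f s = g s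

theorem AgreeOn.crossing {A : Set Line} {a b : Line} {f g : (Line → Bool) → ℂ}
    (h : AgreeOn A f g) (ha : a ∉ A) (hb : b ∉ A) (W : Bool → Bool → Bool → Bool → ℂ) :
    AgreeOn A (crossing W a b f) (TwentyVertex.crossing W a b g) := by
  intro s hs
  rw [crossing_apply, crossing_apply]
  refine Finset.sum_congr rfl fun x _ => Finset.sum_congr rfl fun y _ => ?_
  rw [h _ fun l hl => ?_]
  rw [update_of_ne (ne_of_mem_of_not_mem hl hb), update_of_ne (ne_of_mem_of_not_mem hl ha), hs l hl]

theorem update_eq_self_of {s : Line → Bool} {a : Line} {x : Bool} (h : s a = x) :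
    update s a x = s := by rw [← h, update_eq_self]

/-- An empty diagonal line crosses an empty vertical line. -/
theorem R₃_apply_of_emptyOn (α q : ℂ) (w : ℕ → Spectral) (t : Spectral) (j k : ℕ)
    {f : (Line → Bool) → ℂ} (hd : EmptyOn (.d j) f) (hv : EmptyOn (.v k) f) :
    R₃ α q w t j k f = a₃ α q t (w k) • f := by
  funext s
  have h1 (x y : Bool) (h : x = true ∨ y = true) :
      f (update (update s (.d j) x) (.v k) y) = 0 := by
    rcases h with h | h
    · exact hd _ (by simp [h])
    · exact hv _ (by simp [h])
  rw [R₃, crossing_apply, Pi.smul_apply, smul_eq_mul, Fintype.sum_bool, Fintype.sum_bool,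
    Fintype.sum_bool, h1 true true (by simp), h1 true false (by simp), h1 false true (by simp)]
  -- Only empty states before the crossing contribute, and the ice rule then allows only empty
  -- states after it.
  rcases hs : s (.d j) with _ | _ <;> rcases hs' : s (.v k) with _ | _
  · rw [update_eq_self_of hs, update_eq_self_of hs']
    simp [weight6V]
  · rw [hv s hs']; simp [weight6V]
  · rw [hd s hs]; simp [weight6V]
  · rw [hd s hs]; simp [weight6V]

/-- An empty horizontal line crosses a diagonal line that is empty after the crossing. -/
theorem agreeOn_R₂_of_emptyOn (α q : ℂ) (z : ℕ → Spectral) (t : Spectral) (i j : ℕ)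
    {f : (Line → Bool) → ℂ} (hh : EmptyOn (.h i) f) :
    AgreeOn {.d j} (R₂ α q z t i j f) (a₂ α q (z i) t • f) := by
  intro s hs
  have hd : s (.d j) = false := hs _ rfl
  -- On a horizontal line "before" means East. With the East and South-East edges empty, no path can
  -- leave the vertex, hence none enters from the West or North-West.
  have h1 (y : Bool) : f (update (update s (.h i) true) (.d j) y) = 0 := hh _ (by simp)
  rw [R₂, crossingWest, crossing_apply, Pi.smul_apply, smul_eq_mul, Fintype.sum_bool,
    Fintype.sum_bool, Fintype.sum_bool, h1, h1]
  rcases hs' : s (.h i) with _ | _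
  · rw [update_eq_self_of hs', update_eq_self_of hd, hd]
    simp [weight6V]
  · rw [hh s hs', hd]; simp [weight6V]

/-! ### Layers of the triangle -/

/-- The first `r` crossings, from North-West to South-East, along the diagonal line `m`. -/
def layer (R : ℕ → ℕ → Op) (m : ℕ) : ℕ → Op
  | 0 => 1
  | r + 1 => R (r + 1) (m - r) * layer R m r

/-- The function obtained from the empty state by the first `m` layers of the triangle. -/
noncomputable def triangle (R : ℕ → ℕ → ℕ → Op) : ℕ → (Line → Bool) → ℂ
  | 0 => fun s => open Classical in if ∀ l, s l = false then 1 else 0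
  | m + 1 => layer (R (m + 1)) (m + 1) (m + 1) (triangle R m)

/-- The crossings of the diagonal line `j` with the first vertical and horizontal lines, before
which it is moved across the crossings of these lines. -/
noncomputable def diagonal (α₂ α₃ q : ℂ) (z w : ℕ → Spectral) (t : Spectral) (j m : ℕ) : ℕ → Op
  | 0 => 1
  | r + 1 => R₂ α₂ q z t (r + 1) j * R₃ α₃ q w t j (m - r) * diagonal α₂ α₃ q z w t j m r

/-! ### Moving a diagonal line across a layer. -/

section

variable (α₁ α₂ α₃ q : ℂ) (z w : ℕ → Spectral) (t : Spectral) (j : ℕ)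

theorem commute_R₁_R₂ {i k i' : ℕ} (h : i ≠ i') :
    Commute (R₁ α₁ q z w i k) (R₂ α₂ q z t i' j) := by
  unfold R₁ R₂ crossingWest
  apply commute_crossing <;> simp [h]

theorem commute_R₁_R₃ {i k k' : ℕ} (h : k ≠ k') :
    Commute (R₁ α₁ q z w i k) (R₃ α₃ q w t j k') := by
  unfold R₁ R₃ crossingWest
  apply commute_crossing <;> simp [h]

theorem commute_layer {R : ℕ → ℕ → Op} {m : ℕ} {X : Op} {r : ℕ}
    (h : ∀ i < r, Commute (R (i + 1) (m - i)) X) : Commute (layer R m r) X := by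
  induction r with
  | zero => exact Commute.one_left X
  | succ r ih =>
    exact (h r (Nat.lt_succ_self r)).mul_left (ih fun i hi => h i (hi.trans (Nat.lt_succ_self r)))

theorem commute_diagonal {m r : ℕ} {X : Op}
    (h₂ : ∀ i < r, Commute X (R₂ α₂ q z t (i + 1) j))
    (h₃ : ∀ i < r, Commute X (R₃ α₃ q w t j (m - i))) :
    Commute X (diagonal α₂ α₃ q z w t j m r) := by
  induction r with
  | zero => exact Commute.one_right X
  | succ r ih =>
    have hr := Nat.lt_succ_self r
    exact ((h₂ r hr).mul_right (h₃ r hr)).mul_right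
      (ih (fun i hi => h₂ i (hi.trans hr)) fun i hi => h₃ i (hi.trans hr))

/-- The new factors `R₂` and `R₃` involve a horizontal and a vertical line not used by the earlier
type 1 crossings of the layer, so they commute past them. -/
theorem layer_R20V (hq : q ≠ 0) (m r : ℕ) (hr : r ≤ m) :
    layer (fun i k => R20V (α₁ * α₂ * α₃) q z w t i k j) m r =
      layer (R₁ α₁ q z w) m r * diagonal α₂ α₃ q z w t j m r := by
  induction r with
  | zero => simp [layer, diagonal]
  | succ r ih =>
    have h₂ : Commute (layer (R₁ α₁ q z w) m r) (R₂ α₂ q z t (r + 1) j) :=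
      commute_layer fun i hi => commute_R₁_R₂ _ _ _ _ _ _ _ (by omega)
    have h₃ : Commute (layer (R₁ α₁ q z w) m r) (R₃ α₃ q w t j (m - r)) :=
      commute_layer fun i hi => commute_R₁_R₃ _ _ _ _ _ _ _ (by omega)
    rw [layer, ih (by omega), layer, diagonal, R20V_eq_R₁_mul_R₂_mul_R₃ _ _ _ _ hq]
    simp only [mul_assoc]
    rw [← mul_assoc (layer _ _ _) (R₂ _ _ _ _ _ _), h₂.eq, mul_assoc,
      ← mul_assoc (layer _ _ _) (R₃ _ _ _ _ _ _), h₃.eq, mul_assoc]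

/-- The diagonal line is moved across a layer of the triangle. -/
theorem R₃_mul_diagonal_mul_layer (hq : q ≠ 0) (m r : ℕ) (hr : r ≤ m) :
    R₃ α₃ q w t j (m + 1 - r) * diagonal α₂ α₃ q z w t j (m + 1) r * layer (R₁ α₁ q z w) m r =
      layer (R₁ α₁ q z w) m r * diagonal α₂ α₃ q z w t j m r * R₃ α₃ q w t j (m + 1) := by
  induction r with
  | zero => simp [layer, diagonal]
  | succ r ih =>
    -- The new vertex of the layer lies on `h (r + 1)` and `v (m - r)`, which the earlier crossings
    -- of the diagonal line avoid. It can therefore be brought next to the two new crossings of this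
    -- line to form the Yang-Baxter triple.
    have h₁ : Commute (R₁ α₁ q z w (r + 1) (m - r))
        (R₃ α₃ q w t j (m + 1 - r) * diagonal α₂ α₃ q z w t j (m + 1) r) :=
      (commute_R₁_R₃ _ _ _ _ _ _ _ (by omega)).mul_right
        (commute_diagonal _ _ _ _ _ _ _ (fun i hi => commute_R₁_R₂ _ _ _ _ _ _ _ (by omega))
          fun i hi => commute_R₁_R₃ _ _ _ _ _ _ _ (by omega))
    have h₂ : Commute (layer (R₁ α₁ q z w) m r) (R₂ α₂ q z t (r + 1) j) :=
      commute_layer fun i hi => commute_R₁_R₂ _ _ _ _ _ _ _ (by omega)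
    have h₃ : Commute (layer (R₁ α₁ q z w) m r) (R₃ α₃ q w t j (m - r)) :=
      commute_layer fun i hi => commute_R₁_R₃ _ _ _ _ _ _ _ (by omega)
    have hm : m + 1 - (r + 1) = m - r := by omega
    calc _ = R₃ α₃ q w t j (m - r) * R₂ α₂ q z t (r + 1) j *
          ((R₃ α₃ q w t j (m + 1 - r) * diagonal α₂ α₃ q z w t j (m + 1) r) *
            R₁ α₁ q z w (r + 1) (m - r)) * layer (R₁ α₁ q z w) m r := by
          simp only [layer, diagonal, hm, mul_assoc]
      _ = R₃ α₃ q w t j (m - r) * R₂ α₂ q z t (r + 1) j * R₁ α₁ q z w (r + 1) (m - r) *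
          (R₃ α₃ q w t j (m + 1 - r) * diagonal α₂ α₃ q z w t j (m + 1) r *
            layer (R₁ α₁ q z w) m r) := by
          rw [← h₁.eq]; simp only [mul_assoc]
      _ = R₁ α₁ q z w (r + 1) (m - r) * (R₂ α₂ q z t (r + 1) j * R₃ α₃ q w t j (m - r) *
          layer (R₁ α₁ q z w) m r) * diagonal α₂ α₃ q z w t j m r * R₃ α₃ q w t j (m + 1) := by
          rw [ih (by omega), yang_baxter _ _ _ _ hq]; simp only [mul_assoc]
      _ = _ := by
          rw [← (h₂.mul_right h₃).eq]; simp only [layer, diagonal, mul_assoc]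

/-- Beyond the layer, the diagonal line starts by crossing `v (m + 1)` and ends by crossing `h (m +
1)`, two lines that the layer does not meet. What lies between is the same kind of product for a
smaller `m`, which makes an induction possible. -/
theorem diagonal_mul_layer (hq : q ≠ 0) (m : ℕ) :
    diagonal α₂ α₃ q z w t j (m + 1) (m + 1) * layer (R₁ α₁ q z w) m m =
      layer (R₁ α₁ q z w) m m * R₂ α₂ q z t (m + 1) j * diagonal α₂ α₃ q z w t j m m *
        R₃ α₃ q w t j (m + 1) := by
  have h₂ : Commute (layer (R₁ α₁ q z w) m m) (R₂ α₂ q z t (m + 1) j) :=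
    commute_layer fun i hi => commute_R₁_R₂ _ _ _ _ _ _ _ (by omega)
  rw [diagonal, mul_assoc, mul_assoc, ← mul_assoc (R₃ _ _ _ _ _ _),
    R₃_mul_diagonal_mul_layer _ _ _ _ _ _ _ _ hq m m le_rfl, h₂.eq]
  simp only [mul_assoc]

end

/-! ### Extracting the weights of the empty diagonal lines. -/

theorem AgreeOn.mono {A B : Set Line} {f g : (Line → Bool) → ℂ} (h : AgreeOn A f g) (hAB : A ⊆ B) :
    AgreeOn B f g := fun s hs => h s fun l hl => hs l (hAB hl)

theorem AgreeOn.trans {A : Set Line} {f g k : (Line → Bool) → ℂ} (h : AgreeOn A f g)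
    (h' : AgreeOn A g k) : AgreeOn A f k := fun s hs => (h s hs).trans (h' s hs)

theorem AgreeOn.smul {A : Set Line} {f g : (Line → Bool) → ℂ} (h : AgreeOn A f g) (c : ℂ) :
    AgreeOn A (c • f) (c • g) := fun s hs => by rw [Pi.smul_apply, Pi.smul_apply, h s hs]

section

variable {α₁ α₂ α₃ q : ℂ} {z w : ℕ → Spectral} {t : Spectral} {j : ℕ}

theorem EmptyOn.R₁ {l : Line} {f : (Line → Bool) → ℂ} (hf : EmptyOn l f) {i k : ℕ}
    (hh : l ≠ .h i) (hv : l ≠ .v k) : EmptyOn l (R₁ α₁ q z w i k f) := by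
  rw [TwentyVertex.R₁, crossingWest]
  exact hf.crossing hh hv _

theorem EmptyOn.R₂ {l : Line} {f : (Line → Bool) → ℂ} (hf : EmptyOn l f) {i : ℕ}
    (hh : l ≠ .h i) (hd : l ≠ .d j) : EmptyOn l (R₂ α₂ q z t i j f) := by
  rw [TwentyVertex.R₂, crossingWest]
  exact hf.crossing hh hd _

theorem EmptyOn.R₃ {l : Line} {f : (Line → Bool) → ℂ} (hf : EmptyOn l f) {k : ℕ}
    (hd : l ≠ .d j) (hv : l ≠ .v k) : EmptyOn l (R₃ α₃ q w t j k f) := by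
  rw [TwentyVertex.R₃]
  exact hf.crossing hd hv _

theorem AgreeOn.R₁ {A : Set Line} {f g : (Line → Bool) → ℂ} (hfg : AgreeOn A f g) {i k : ℕ}
    (hh : .h i ∉ A) (hv : .v k ∉ A) : AgreeOn A (R₁ α₁ q z w i k f) (R₁ α₁ q z w i k g) := by
  rw [TwentyVertex.R₁, crossingWest]
  exact hfg.crossing hh hv _

theorem AgreeOn.R₂ {A : Set Line} {f g : (Line → Bool) → ℂ} (hfg : AgreeOn A f g) {i : ℕ}
    (hh : .h i ∉ A) (hd : .d j ∉ A) : AgreeOn A (R₂ α₂ q z t i j f) (R₂ α₂ q z t i j g) := by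
  rw [TwentyVertex.R₂, crossingWest]
  exact hfg.crossing hh hd _

theorem AgreeOn.R₃ {A : Set Line} {f g : (Line → Bool) → ℂ} (hfg : AgreeOn A f g) {k : ℕ}
    (hd : .d j ∉ A) (hv : .v k ∉ A) : AgreeOn A (R₃ α₃ q w t j k f) (R₃ α₃ q w t j k g) := by
  rw [TwentyVertex.R₃]
  exact hfg.crossing hd hv _

theorem EmptyOn.layer_R₁ {l : Line} {f : (Line → Bool) → ℂ} (hf : EmptyOn l f) {m r : ℕ}
    (hh : ∀ i, 1 ≤ i → i ≤ r → l ≠ .h i) (hv : ∀ k ≤ m, l ≠ .v k) :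
    EmptyOn l (layer (TwentyVertex.R₁ α₁ q z w) m r f) := by
  induction r with
  | zero => exact hf
  | succ r ih =>
    rw [layer, Module.End.mul_apply]
    exact (ih fun i h hi => hh i h (hi.trans r.le_succ)).R₁ (hh _ (Nat.le_add_left 1 r) le_rfl)
      (hv _ (Nat.sub_le m r))

theorem EmptyOn.diagonal {l : Line} {f : (Line → Bool) → ℂ} (hf : EmptyOn l f) {m r : ℕ}
    (hh : ∀ i ≤ r, l ≠ .h i) (hv : ∀ k ≤ m, l ≠ .v k) (hd : l ≠ .d j) :
    EmptyOn l (diagonal α₂ α₃ q z w t j m r f) := by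
  induction r with
  | zero => exact hf
  | succ r ih =>
    rw [TwentyVertex.diagonal, Module.End.mul_apply, Module.End.mul_apply]
    exact ((ih fun i hi => hh i (hi.trans r.le_succ)).R₃ hd (hv _ (Nat.sub_le m r))).R₂
      (hh _ le_rfl) hd

theorem AgreeOn.layer_R₁ {A : Set Line} {f g : (Line → Bool) → ℂ} (hfg : AgreeOn A f g)
    (hh : ∀ i, .h i ∉ A) (hv : ∀ k, .v k ∉ A) (m r : ℕ) :
    AgreeOn A (layer (TwentyVertex.R₁ α₁ q z w) m r f)
      (layer (TwentyVertex.R₁ α₁ q z w) m r g) := by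
  induction r with
  | zero => exact hfg
  | succ r ih =>
    rw [layer, Module.End.mul_apply, Module.End.mul_apply]
    exact ih.R₁ (hh _) (hv _)

theorem AgreeOn.diagonal {A : Set Line} {f g : (Line → Bool) → ℂ} (hfg : AgreeOn A f g)
    (hh : ∀ i, .h i ∉ A) (hv : ∀ k, .v k ∉ A) (hd : .d j ∉ A) (m r : ℕ) :
    AgreeOn A (diagonal α₂ α₃ q z w t j m r f) (diagonal α₂ α₃ q z w t j m r g) := by
  induction r with
  | zero => exact hfg
  | succ r ih =>
    rw [TwentyVertex.diagonal, Module.End.mul_apply, Module.End.mul_apply, Module.End.mul_apply,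
      Module.End.mul_apply]
    exact (ih.R₃ hd (hv _)).R₂ (hh _) hd

variable (α₁ q z w) in
/-- The six-vertex model on the triangle, with the weights of sublattice 1. -/
noncomputable def triangle6V : ℕ → (Line → Bool) → ℂ := triangle fun _ => R₁ α₁ q z w

variable (α₂ α₃ q z w t) in
/-- The weight of an empty diagonal line which is crossed by `m` empty vertical and `m` empty
horizontal lines. -/
noncomputable def diagonalWeight (m : ℕ) : ℂ :=
  (∏ i ∈ Finset.Icc 1 m, a₂ α₂ q (z i) t) * ∏ k ∈ Finset.Icc 1 m, a₃ α₃ q t (w k)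

/-- A line not met by the triangle keeps the empty state imposed by `triangle _ 0`. -/
theorem emptyOn_triangle6V {l : Line} {m : ℕ} (hh : ∀ i, 1 ≤ i → i ≤ m → l ≠ .h i)
    (hv : ∀ k ≤ m, l ≠ .v k) : EmptyOn l (triangle6V α₁ q z w m) := by
  induction m with
  | zero =>
    intro s hs
    exact if_neg fun h => by simp [h l] at hs
  | succ m ih =>
    exact (ih (fun i h hi => hh i h (hi.trans m.le_succ))
      fun k hk => hv k (hk.trans m.le_succ)).layer_R₁ hh hv

/-- The truncated `m - 1` is harmless: for `m = 0` the layer is the identity. -/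
theorem triangle6V_eq_layer (m : ℕ) : triangle6V α₁ q z w m =
    layer (R₁ α₁ q z w) m m (triangle6V α₁ q z w (m - 1)) := by
  cases m <;> rfl

/-- The diagonal line of layer `m` is slid across the triangle of size `m - 1`. Only agreement on an
empty exit of this line can be expected: the factor `a₂` relies on its state after the crossing. -/
theorem agreeOn_diagonal_triangle6V (hq : q ≠ 0) (m : ℕ) :
    AgreeOn {.d j} (diagonal α₂ α₃ q z w t j m m (triangle6V α₁ q z w (m - 1)))
      (diagonalWeight α₂ α₃ q z w t m • triangle6V α₁ q z w (m - 1)) := by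
  induction m with
  | zero => intro s _; simp [diagonal, diagonalWeight]
  | succ m ih =>
    have hd : EmptyOn (.d j) (triangle6V α₁ q z w (m - 1)) :=
      emptyOn_triangle6V (by simp) (by simp)
    have hv : EmptyOn (.v (m + 1)) (triangle6V α₁ q z w (m - 1)) :=
      emptyOn_triangle6V (by simp) (fun k hk => by simp; omega)
    have hh : EmptyOn (.h (m + 1)) (triangle6V α₁ q z w (m - 1)) :=
      emptyOn_triangle6V (fun k _ hk => by simp; omega) (by simp)
    have hg : EmptyOn (.h (m + 1))
        (diagonal α₂ α₃ q z w t j m m (triangle6V α₁ q z w (m - 1))) :=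
      hh.diagonal (fun k hk => by simp; omega) (by simp) (by simp)
    -- `R₃` acts first, directly on the smaller triangle, where both of its lines are still empty;
    -- it becomes a scalar.
    have key : diagonal α₂ α₃ q z w t j (m + 1) (m + 1) (triangle6V α₁ q z w m) =
        a₃ α₃ q t (w (m + 1)) • layer (R₁ α₁ q z w) m m (R₂ α₂ q z t (m + 1) j
          (diagonal α₂ α₃ q z w t j m m (triangle6V α₁ q z w (m - 1)))) := by
      rw [triangle6V_eq_layer, ← Module.End.mul_apply, diagonal_mul_layer _ _ _ _ _ _ _ _ hq,
        Module.End.mul_apply, R₃_apply_of_emptyOn _ _ _ _ _ _ hd hv, map_smul,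
        Module.End.mul_apply, Module.End.mul_apply]
    rw [Nat.add_sub_cancel, key]
    -- The layer of type 1 crossings does not involve the diagonal line, so agreement passes through
    -- it and the layer rebuilds the triangle of size `m`.
    have h := ((agreeOn_R₂_of_emptyOn α₂ q z t (m + 1) j hg).trans (ih.smul _)).layer_R₁
      (α₁ := α₁) (q := q) (z := z) (w := w) (by simp) (by simp) m m
    rw [map_smul, map_smul, ← triangle6V_eq_layer] at h
    have hw : diagonalWeight α₂ α₃ q z w t (m + 1) = a₃ α₃ q t (w (m + 1)) *
        (a₂ α₂ q (z (m + 1)) t * diagonalWeight α₂ α₃ q z w t m) := by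
      simp only [diagonalWeight, Finset.prod_Icc_succ_top (Nat.le_add_left 1 m)]
      ring
    rw [hw, mul_smul, mul_smul]
    exact h.smul _

/-- The diagonal lines with a number at most `m`. -/
def diagonalLines (m : ℕ) : Set Line := {l | ∃ j ≤ m, l = .d j}

variable (α₁ α₂ α₃) in
/-- All diagonal lines are moved to the North-East of the triangle. -/
theorem agreeOn_triangle_R20V (hq : q ≠ 0) (t : ℕ → Spectral) (m : ℕ) :
    AgreeOn (diagonalLines m)
      (triangle (fun j i k => R20V (α₁ * α₂ * α₃) q z w (t j) i k j) m)
      ((∏ j ∈ Finset.Icc 1 m, diagonalWeight α₂ α₃ q z w (t j) j) • triangle6V α₁ q z w m) := by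
  induction m with
  | zero => intro s _; simp [triangle6V, triangle]
  | succ m ih =>
    have hA : diagonalLines m ⊆ diagonalLines (m + 1) :=
      fun l ⟨j, hj, hl⟩ => ⟨j, hj.trans m.le_succ, hl⟩
    have hA' : {Line.d (m + 1)} ⊆ diagonalLines (m + 1) := fun l hl => ⟨m + 1, le_rfl, hl⟩
    have h := (ih.diagonal (α₂ := α₂) (α₃ := α₃) (q := q) (z := z) (w := w) (t := t (m + 1))
      (j := m + 1) (by simp [diagonalLines]) (by simp [diagonalLines])
      (by simp [diagonalLines]) (m + 1) (m + 1)).mono hA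
    rw [map_smul] at h
    have h' := ((agreeOn_diagonal_triangle6V (α₁ := α₁) (α₂ := α₂) (α₃ := α₃) (z := z) (w := w)
      (t := t (m + 1)) (j := m + 1) hq (m + 1)).mono hA').smul
      (∏ j ∈ Finset.Icc 1 m, diagonalWeight α₂ α₃ q z w (t j) j)
    have h'' := (h.trans h').layer_R₁ (α₁ := α₁) (q := q) (z := z) (w := w)
      (by simp [diagonalLines]) (by simp [diagonalLines]) (m + 1) (m + 1)
    rw [map_smul, map_smul, smul_smul] at h''
    rw [triangle, layer_R20V _ _ _ _ _ _ _ _ hq _ _ le_rfl, Module.End.mul_apply,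
      Finset.prod_Icc_succ_top (Nat.le_add_left 1 m)]
    exact h''

end

/-! ### Sums over configurations -/

/-- The line that contains an edge. -/
def Edge.line : Edge → Line
  | .h i _ => .h i
  | .v k _ => .v k
  | .d j _ => .d j

/-- The position of an edge on its line. -/
def Edge.pos : Edge → ℕ
  | .h _ k => k
  | .v _ i => i
  | .d _ i => i

/-- The orientations given by `S` for the edges of `A`, and by the states `s` of the lines for all
other edges. -/
def fill (A S : Finset Edge) (s : Line → Bool) (e : Edge) : Bool :=
  if e ∈ A then decide (e ∈ S) else s e.line

open Classical in
/-- The sum of the products of the weights `wt` over the configurations on a set `V` of vertices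
for which the first edges of all lines are empty.  The edges of `inp p` precede the vertex `p`, and
the edges that do not precede a vertex of `V` are in the state given by `s`. -/
noncomputable def configSum (inp : ℕ × ℕ → Finset Edge) (wt : ℕ × ℕ → (Edge → Bool) → ℂ)
    (V : Finset (ℕ × ℕ)) (s : Line → Bool) : ℂ :=
  ∑ S ∈ (V.biUnion inp).powerset,
    if ∀ e : Edge, e.pos = 1 → fill (V.biUnion inp) S s e = false then
      ∏ p ∈ V, wt p (fill (V.biUnion inp) S s) else 0

/-- Seen from the region with inputs `A`, the edges of `B` are exits, so their orientation becomes
the state of their line. The hypothesis `he` keeps away from edges further along these lines. -/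
theorem fill_union_left {A B S X : Finset Edge} (hAB : Disjoint B A) (hS : S ⊆ A) (hX : X ⊆ B)
    (hB : Set.InjOn Edge.line B) {s : Line → Bool} {e : Edge}
    (he : e.line ∈ B.image Edge.line → e ∈ A ∪ B) :
    fill (A ∪ B) (S ∪ X) s e = fill A S (fun l => if l ∈ B.image Edge.line then
      decide (l ∈ X.image Edge.line) else s l) e := by
  unfold fill
  by_cases hA : e ∈ A
  · have : e ∉ X := fun h => Finset.disjoint_left.1 hAB (hX h) hA
    simp [hA, this]
  · by_cases heB : e ∈ B
    · have h1 : e ∉ S := fun h => hA (hS h)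
      have h2 : e.line ∈ B.image Edge.line := Finset.mem_image_of_mem _ heB
      have h3 : e.line ∈ X.image Edge.line ↔ e ∈ X := by
        refine ⟨fun h => ?_, Finset.mem_image_of_mem _⟩
        obtain ⟨e', he', hl⟩ := Finset.mem_image.1 h
        rwa [← hB (hX he') heB hl]
      beta_reduce
      rw [if_pos (Finset.mem_union_right _ heB), if_neg hA, if_pos h2]
      simp [h1, h3]
    · have h1 : e ∉ A ∪ B := by simp [hA, heB]
      beta_reduce
      rw [if_neg h1, if_neg hA, if_neg fun h => h1 (he h)]

theorem fill_union_right {A B S X : Finset Edge} (hAB : Disjoint B A) (hS : S ⊆ A)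
    {s : Line → Bool} {e : Edge} (he : e ∈ A → e ∈ B) :
    fill (A ∪ B) (S ∪ X) s e = fill B X s e := by
  have hA : e ∉ A := fun h => Finset.disjoint_left.1 hAB (he h) h
  have h1 : e ∉ S := fun h => hA (hS h)
  simp [fill, hA, h1]

theorem sum_powerset_union {A B : Finset Edge} (hAB : Disjoint B A) (F : Finset Edge → ℂ) :
    ∑ S ∈ (A ∪ B).powerset, F S = ∑ X ∈ B.powerset, ∑ S ∈ A.powerset, F (S ∪ X) := by
  rw [← Finset.sum_product']
  symm
  refine Finset.sum_nbij' (fun x => x.2 ∪ x.1) (fun S => (S ∩ B, S ∩ A)) ?_ ?_ ?_ ?_ ?_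
  · rintro ⟨X, S⟩ h
    simp only [Finset.mem_product, Finset.mem_powerset] at h ⊢
    exact Finset.union_subset_union h.2 h.1
  · intro S _
    simp [Finset.inter_subset_right]
  · rintro ⟨X, S⟩ h
    simp only [Finset.mem_product, Finset.mem_powerset] at h
    have h1 : Disjoint S B := hAB.symm.mono_left h.2
    have h2 : Disjoint X A := hAB.mono_left h.1
    simp only [Finset.union_inter_distrib_right, Finset.disjoint_iff_inter_eq_empty.1 h1,
      Finset.disjoint_iff_inter_eq_empty.1 h2, Finset.inter_eq_left.2 h.1,
      Finset.inter_eq_left.2 h.2, Finset.empty_union, Finset.union_empty]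
  · intro S hS
    rw [Finset.mem_powerset] at hS
    simp only [← Finset.inter_union_distrib_left, Finset.inter_eq_left.2 hS]
  · intro _ _
    rfl

/-- A vertex `p` is added to `V`. -/
theorem configSum_insert {inp adj : ℕ × ℕ → Finset Edge} {wt : ℕ × ℕ → (Edge → Bool) → ℂ}
    (hwt : ∀ p σ σ', (∀ e ∈ adj p, σ e = σ' e) → wt p σ = wt p σ')
    {V : Finset (ℕ × ℕ)} {p : ℕ × ℕ} (hp : p ∉ V) (hdisj : Disjoint (inp p) (V.biUnion inp))
    (hline : Set.InjOn Edge.line (inp p))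
    (hV : ∀ r ∈ V, ∀ e ∈ adj r, e.line ∈ (inp p).image Edge.line → e ∈ V.biUnion inp ∪ inp p)
    (hadj : ∀ e ∈ adj p, e ∈ V.biUnion inp → e ∈ inp p)
    (hpos : ∀ e : Edge, e.pos = 1 → e.line ∈ (inp p).image Edge.line → e ∈ V.biUnion inp ∪ inp p)
    (s : Line → Bool) :
    configSum inp wt (insert p V) s = ∑ X ∈ (inp p).powerset, wt p (fill (inp p) X s) *
      configSum inp wt V (fun l => if l ∈ (inp p).image Edge.line then
        decide (l ∈ X.image Edge.line) else s l) := by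
  have hU : (insert p V).biUnion inp = V.biUnion inp ∪ inp p := by
    rw [Finset.biUnion_insert, Finset.union_comm]
  -- A configuration splits into the edges `X` entering `p` and the edges `S` entering `V`. For `V`,
  -- the set `X` prescribes the exit states on the lines of `p`.
  rw [configSum, hU, sum_powerset_union hdisj]
  refine Finset.sum_congr rfl fun X hX => ?_
  rw [configSum, Finset.mul_sum]
  refine Finset.sum_congr rfl fun S hS => ?_
  rw [Finset.mem_powerset] at hX hS
  have h1 : (∀ e : Edge, e.pos = 1 → fill (V.biUnion inp ∪ inp p) (S ∪ X) s e = false) ↔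
      ∀ e : Edge, e.pos = 1 → fill (V.biUnion inp) S (fun l => if l ∈ (inp p).image Edge.line then
        decide (l ∈ X.image Edge.line) else s l) e = false :=
    forall₂_congr fun e he => by rw [fill_union_left hdisj hS hX hline (hpos e he)]
  split_ifs with h h' h'
  · rw [Finset.prod_insert hp]
    congr 1
    · exact hwt _ _ _ fun e he => fill_union_right hdisj hS (hadj e he)
    · exact Finset.prod_congr rfl fun r hr => hwt _ _ _ fun e he =>
        fill_union_left hdisj hS hX hline (hV r hr e he)
  · exact absurd (h1.1 h) h'
  · exact absurd (h1.2 h') h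
  · rw [mul_zero]

/-- A sum over sets of edges with prescribed boundary conditions. -/
theorem sum_filter_eq_configSum {inp adj : ℕ × ℕ → Finset Edge}
    {wt : ℕ × ℕ → (Edge → Bool) → ℂ}
    (hwt : ∀ p σ σ', (∀ e ∈ adj p, σ e = σ' e) → wt p σ = wt p σ')
    {V : Finset (ℕ × ℕ)} {E : Finset Edge} {s : Line → Bool} {bdry : Finset Edge → Prop}
    [DecidablePred bdry] (hinp : V.biUnion inp ⊆ E) (hadj : ∀ p ∈ V, adj p ⊆ E)
    (hbdry : ∀ S ⊆ E, bdry S ↔ (∀ e ∈ E, e ∉ V.biUnion inp → (e ∈ S ↔ s e.line = true)) ∧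
      ∀ e ∈ E, e.pos = 1 → e ∉ S)
    (hs : ∀ e : Edge, e.pos = 1 → e ∉ E → s e.line = false) :
    ∑ S ∈ E.powerset with bdry S, ∏ p ∈ V, wt p (occ S) = configSum inp wt V s := by
  classical
  rw [configSum, ← Finset.sum_filter]
  have hfill {S : Finset Edge} (hS : S ⊆ E) (hb : bdry S) {e : Edge} (he : e ∈ E) :
      fill (V.biUnion inp) (S ∩ V.biUnion inp) s e = occ S e := by
    unfold fill occ
    split_ifs with h
    · simp [h]
    · have := ((hbdry S hS).1 hb).1 e he h
      rcases h' : s e.line <;> simp [this, h']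
  -- Edges that precede no vertex of `V` are fixed by the boundary condition: one map forgets them,
  -- the other restores them from `s`.
  refine Finset.sum_nbij' (fun S => S ∩ V.biUnion inp)
    (fun S => S ∪ E.filter fun e => e ∉ V.biUnion inp ∧ s e.line = true) ?_ ?_ ?_ ?_ ?_
  · intro S hS
    rw [Finset.mem_filter, Finset.mem_powerset] at hS ⊢
    refine ⟨Finset.inter_subset_right, fun e he => ?_⟩
    by_cases heE : e ∈ E
    · rw [hfill hS.1 hS.2 heE]
      simpa [occ] using ((hbdry S hS.1).1 hS.2).2 e heE he
    · rw [fill, if_neg fun h => heE (hinp h)]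
      exact hs e he heE
  · intro S hS
    rw [Finset.mem_filter, Finset.mem_powerset] at hS ⊢
    have hsub : (S ∪ E.filter fun e => e ∉ V.biUnion inp ∧ s e.line = true) ⊆ E :=
      Finset.union_subset (hS.1.trans hinp) (Finset.filter_subset _ _)
    refine ⟨hsub, (hbdry _ hsub).2 ⟨fun e he heV => ?_, fun e he hpos => ?_⟩⟩
    · have : e ∉ S := fun h => heV (hS.1 h)
      simp only [Finset.mem_union, this, Finset.mem_filter, he, heV, not_false_eq_true, true_and,
        false_or]
    · have := hS.2 e hpos
      unfold fill at this
      simp only [Finset.mem_union, Finset.mem_filter, not_or]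
      split_ifs at this with h
      · exact ⟨by simpa using this, fun h' => h'.2.1 h⟩
      · exact ⟨fun h' => h (hS.1 h'), fun h' => by simp [this] at h'⟩
  · intro S hS
    rw [Finset.mem_filter, Finset.mem_powerset] at hS
    ext e
    simp only [Finset.mem_union, Finset.mem_inter, Finset.mem_filter]
    by_cases heE : e ∈ E
    · by_cases h : e ∈ V.biUnion inp
      · simp only [h, not_true_eq_false, false_and, and_false, or_false, and_true]
      · have := ((hbdry S hS.1).1 hS.2).1 e heE h
        simp only [h, this, heE, and_false, not_false_eq_true, true_and, false_or]
    · simp only [heE, false_and, or_false]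
      exact ⟨fun h => h.1, fun h => absurd (hS.1 h) heE⟩
  · intro S hS
    rw [Finset.mem_filter, Finset.mem_powerset] at hS
    ext e
    simp only [Finset.mem_union, Finset.mem_inter, Finset.mem_filter]
    constructor
    · rintro ⟨h | h, h'⟩
      · exact h
      · exact absurd h' h.2.1
    · exact fun h => ⟨Or.inl h, hS.1 h⟩
  · intro S hS
    rw [Finset.mem_filter, Finset.mem_powerset] at hS
    exact Finset.prod_congr rfl fun p hp => hwt _ _ _ fun e he =>
      (hfill hS.1 hS.2 (hadj p hp he)).symm

/-! ### Adding vertices in the twenty-vertex and in the six-vertex model -/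

theorem sum_powerset_pair {a b : Edge} (hab : a ≠ b) (G : Bool → Bool → ℂ) :
    ∑ X ∈ ({a, b} : Finset Edge).powerset, G (decide (a ∈ X)) (decide (b ∈ X)) =
      ∑ x, ∑ y, G x y := by
  have h : ({b} : Finset Edge) = insert b ∅ := rfl
  rw [Finset.sum_powerset_insert (by simpa), h, Finset.sum_powerset_insert (by simp),
    Finset.sum_powerset_insert (by simp)]
  simp only [Finset.powerset_empty, Finset.sum_singleton, Fintype.sum_bool, Finset.mem_insert,
    Finset.notMem_empty, hab, hab.symm, or_false, or_true, decide_true, decide_false]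
  ring

theorem sum_powerset_triple {a b c : Edge} (hab : a ≠ b) (hac : a ≠ c) (hbc : b ≠ c)
    (G : Bool → Bool → Bool → ℂ) :
    ∑ X ∈ ({a, b, c} : Finset Edge).powerset,
        G (decide (a ∈ X)) (decide (b ∈ X)) (decide (c ∈ X)) =
      ∑ x, ∑ y, ∑ z, G x y z := by
  have ha {X : Finset Edge} (hX : X ∈ ({b, c} : Finset Edge).powerset) : a ∉ X := fun h => by
    have := Finset.mem_powerset.1 hX h
    simp [hab, hac] at this
  rw [Finset.sum_powerset_insert (by simp [hab, hac]), Fintype.sum_bool, add_comm,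
    ← sum_powerset_pair hbc, ← sum_powerset_pair hbc]
  congr 1 <;> refine Finset.sum_congr rfl fun X hX => ?_
  · simp [hab.symm, hac.symm]
  · simp [ha hX]

theorem ite_mem_pair_eq_update (s : Line → Bool) {a b : Line} (hab : a ≠ b) {T : Finset Line}
    {x y : Bool} (hx : decide (a ∈ T) = x) (hy : decide (b ∈ T) = y) :
    (fun l => if l ∈ ({a, b} : Finset Line) then decide (l ∈ T) else s l) =
      update (update s a x) b y := by
  funext l
  by_cases hb : l = b
  · subst hb; simp [← hy]
  by_cases ha : l = a
  · subst ha; simp [← hx, hab]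
  simp [ha, hb]

theorem ite_mem_triple_eq_update (s : Line → Bool) {a b c : Line} (hab : a ≠ b) (hac : a ≠ c)
    (hbc : b ≠ c) {T : Finset Line} {x y u : Bool} (hx : decide (a ∈ T) = x)
    (hy : decide (b ∈ T) = y) (hu : decide (c ∈ T) = u) :
    (fun l => if l ∈ ({a, b, c} : Finset Line) then decide (l ∈ T) else s l) =
      update (update (update s a x) b y) c u := by
  funext l
  by_cases hc : l = c
  · subst hc; simp [← hu]
  by_cases hb : l = b
  · subst hb; simp [← hy, hbc]
  by_cases ha : l = a
  · subst ha; simp [← hx, hab, hac]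
  simp [ha, hb, hc]

/-- The set `V` of vertices contains, with a vertex, all vertices that precede it on its horizontal
and on its vertical line. -/
structure Closed (V : Finset (ℕ × ℕ)) : Prop where
  one_le : ∀ {i k}, (i, k) ∈ V → 1 ≤ i ∧ 1 ≤ k
  mem_h : ∀ {i k k'}, (i, k) ∈ V → 1 ≤ k' → k' ≤ k → (i, k') ∈ V
  mem_v : ∀ {i k i'}, (i, k) ∈ V → 1 ≤ i' → i' ≤ i → (i', k) ∈ V

/-- The set `V` of vertices contains, with a vertex, all vertices that precede it on its diagonal
line. -/
def ClosedDiagonal (V : Finset (ℕ × ℕ)) : Prop :=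
  ∀ {i k i'}, (i, k) ∈ V → 1 ≤ i' → i' ≤ i → (i', i + k - i') ∈ V

def inputs6V (p : ℕ × ℕ) : Finset Edge := {Edge.h p.1 p.2, Edge.v p.2 p.1}

def around6V (p : ℕ × ℕ) : Finset Edge :=
  {Edge.h p.1 (p.2 + 1), Edge.v p.2 p.1, Edge.h p.1 p.2, Edge.v p.2 (p.1 + 1)}

def inputs20V (p : ℕ × ℕ) : Finset Edge :=
  {Edge.h p.1 p.2, Edge.v p.2 p.1, Edge.d (p.1 + p.2 - 1) p.1}

def around20V (p : ℕ × ℕ) : Finset Edge :=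
  {Edge.h p.1 (p.2 + 1), Edge.v p.2 p.1, Edge.d (p.1 + p.2 - 1) p.1,
    Edge.h p.1 p.2, Edge.v p.2 (p.1 + 1), Edge.d (p.1 + p.2 - 1) (p.1 + 1)}

noncomputable def vertexWeight6V (α q : ℂ) (z w : ℕ → Spectral) (p : ℕ × ℕ) (σ : Edge → Bool) : ℂ :=
  weight6V (a₁ α q (z p.1) (w p.2)) (b₁ α q (z p.1) (w p.2)) (c₁ α q (z p.1) (w p.2))
    (σ (.h p.1 (p.2 + 1))) (σ (.v p.2 p.1)) (σ (.h p.1 p.2)) (σ (.v p.2 (p.1 + 1)))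

noncomputable def vertexWeight20V (ν q : ℂ) (z t w : ℕ → Spectral) (p : ℕ × ℕ)
    (σ : Edge → Bool) : ℂ :=
  weight20V ν q (z p.1) (t (p.1 + p.2 - 1)) (w p.2)
    (σ (.h p.1 (p.2 + 1))) (σ (.v p.2 p.1)) (σ (.d (p.1 + p.2 - 1) p.1))
    (σ (.h p.1 p.2)) (σ (.v p.2 (p.1 + 1))) (σ (.d (p.1 + p.2 - 1) (p.1 + 1)))

theorem vertexWeight6V_congr (α q : ℂ) (z w : ℕ → Spectral) (p : ℕ × ℕ) (σ σ' : Edge → Bool)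
    (h : ∀ e ∈ around6V p, σ e = σ' e) :
    vertexWeight6V α q z w p σ = vertexWeight6V α q z w p σ' := by
  simp only [around6V, Finset.mem_insert, Finset.mem_singleton, forall_eq_or_imp, forall_eq] at h
  obtain ⟨h1, h2, h3, h4⟩ := h
  rw [vertexWeight6V, vertexWeight6V, h1, h2, h3, h4]

theorem vertexWeight20V_congr (ν q : ℂ) (z t w : ℕ → Spectral) (p : ℕ × ℕ) (σ σ' : Edge → Bool)
    (h : ∀ e ∈ around20V p, σ e = σ' e) :
    vertexWeight20V ν q z t w p σ = vertexWeight20V ν q z t w p σ' := by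
  simp only [around20V, Finset.mem_insert, Finset.mem_singleton, forall_eq_or_imp, forall_eq] at h
  obtain ⟨h1, h2, h3, h4, h5, h6⟩ := h
  rw [vertexWeight20V, vertexWeight20V, h1, h2, h3, h4, h5, h6]

section

variable {V : Finset (ℕ × ℕ)} {i k j : ℕ}

theorem h_mem_inputs6V : Edge.h i k ∈ V.biUnion inputs6V ↔ (i, k) ∈ V := by
  simp [inputs6V]

theorem v_mem_inputs6V : Edge.v k i ∈ V.biUnion inputs6V ↔ (i, k) ∈ V := by
  simp only [inputs6V, Finset.mem_biUnion, Finset.mem_insert, Finset.mem_singleton, reduceCtorEq,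
    Edge.v.injEq, false_or, Prod.exists]
  exact ⟨fun ⟨a, b, h, h1, h2⟩ => h1 ▸ h2 ▸ h, fun h => ⟨i, k, h, rfl, rfl⟩⟩

theorem h_mem_inputs20V : Edge.h i k ∈ V.biUnion inputs20V ↔ (i, k) ∈ V := by
  simp [inputs20V]

theorem v_mem_inputs20V : Edge.v k i ∈ V.biUnion inputs20V ↔ (i, k) ∈ V := by
  simp only [inputs20V, Finset.mem_biUnion, Finset.mem_insert, Finset.mem_singleton, reduceCtorEq,
    Edge.v.injEq, false_or, or_false, Prod.exists]
  exact ⟨fun ⟨a, b, h, h1, h2⟩ => h1 ▸ h2 ▸ h, fun h => ⟨i, k, h, rfl, rfl⟩⟩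

theorem d_mem_inputs20V : Edge.d j i ∈ V.biUnion inputs20V ↔ ∃ k, (i, k) ∈ V ∧ j = i + k - 1 := by
  simp only [inputs20V, Finset.mem_biUnion, Finset.mem_insert, Finset.mem_singleton, reduceCtorEq,
    Edge.d.injEq, false_or, Prod.exists]
  exact ⟨fun ⟨a, b, h, h1, h2⟩ => ⟨b, h2 ▸ h, h2 ▸ h1⟩, fun ⟨b, h, h1⟩ => ⟨i, b, h, h1, rfl⟩⟩

theorem line_mem_image_iff {B X : Finset Edge} (hB : Set.InjOn Edge.line B) (hX : X ⊆ B) {e : Edge}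
    (he : e ∈ B) : e.line ∈ X.image Edge.line ↔ e ∈ X := by
  refine ⟨fun h => ?_, Finset.mem_image_of_mem _⟩
  obtain ⟨e', he', hl⟩ := Finset.mem_image.1 h
  rwa [← hB (hX he') he hl]

theorem injOn_line_inputs6V (p : ℕ × ℕ) : Set.InjOn Edge.line (inputs6V p) := by
  simp [Set.InjOn, inputs6V, Edge.line]

theorem injOn_line_inputs20V (p : ℕ × ℕ) : Set.InjOn Edge.line (inputs20V p) := by
  simp [Set.InjOn, inputs20V, Edge.line]

/-- A vertex is added to a region of the six-vertex model. -/
theorem configSum_insert_6V (α q : ℂ) (z w : ℕ → Spectral) (hp : (i, k) ∉ V)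
    (hV' : Closed (insert (i, k) V)) (hV : Closed V) :
    configSum inputs6V (vertexWeight6V α q z w) (insert (i, k) V) =
      R₁ α q z w i k (configSum inputs6V (vertexWeight6V α q z w) V) := by
  have hmem := Finset.mem_insert_self (i, k) V
  have hU : V.biUnion inputs6V ∪ inputs6V (i, k) = (insert (i, k) V).biUnion inputs6V := by
    rw [Finset.biUnion_insert, Finset.union_comm]
  have hi := hV'.one_le hmem
  have himage : (inputs6V (i, k)).image Edge.line = {.h i, .v k} := rfl
  -- The new vertex is the last one on each of its lines, since otherwise closedness of `V` would
  -- already put it in `V`.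
  have hlt_h {b : ℕ} (h : (i, b) ∈ V) : b < k := by
    by_contra! hb
    exact hp (hV.mem_h h hi.2 hb)
  have hlt_v {a : ℕ} (h : (a, k) ∈ V) : a < i := by
    by_contra! ha
    exact hp (hV.mem_v h hi.1 ha)
  funext s
  rw [configSum_insert (vertexWeight6V_congr α q z w) hp ?_ (injOn_line_inputs6V _), himage]
  · rw [R₁, crossingWest, crossing_apply,
      ← sum_powerset_pair (a := Edge.h i k) (b := Edge.v k i) (by simp)]
    refine Finset.sum_congr rfl fun X hX => ?_
    have hX' : X ⊆ inputs6V (i, k) := Finset.mem_powerset.1 hX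
    have hh := line_mem_image_iff (injOn_line_inputs6V _) hX' (e := .h i k) (by simp [inputs6V])
    have hv := line_mem_image_iff (injOn_line_inputs6V _) hX' (e := .v k i) (by simp [inputs6V])
    rw [ite_mem_pair_eq_update s (a := .h i) (b := .v k) (by simp) (decide_eq_decide.2 hh) (decide_eq_decide.2 hv)]
    congr 1
    simp [vertexWeight6V, fill, inputs6V, Edge.line]
  · intro r hr e he hl
    obtain ⟨a, b⟩ := r
    rw [himage] at hl
    rw [hU]
    simp only [around6V, Finset.mem_insert, Finset.mem_singleton] at he
    rcases he with rfl | rfl | rfl | rfl <;> simp [Edge.line] at hl <;> subst hl <;>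
      simp only [h_mem_inputs6V, v_mem_inputs6V]
    · exact hV'.mem_h hmem (by omega) (hlt_h hr)
    · exact Finset.mem_insert_of_mem hr
    · exact Finset.mem_insert_of_mem hr
    · exact hV'.mem_v hmem (by omega) (hlt_v hr)
  · intro e he heV
    simp only [around6V, Finset.mem_insert, Finset.mem_singleton] at he
    rcases he with rfl | rfl | rfl | rfl <;> simp only [h_mem_inputs6V, v_mem_inputs6V] at heV
    · exact absurd (hlt_h heV) (by omega)
    · simp [inputs6V]
    · simp [inputs6V]
    · exact absurd (hlt_v heV) (by omega)
  · intro e he hl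
    rw [himage] at hl
    rw [hU]
    rcases e with ⟨a, b⟩ | ⟨b, a⟩ | ⟨c, a⟩ <;> simp [Edge.line] at hl <;> subst hl <;>
      simp only [Edge.pos] at he <;> subst he <;> simp only [h_mem_inputs6V, v_mem_inputs6V]
    · exact hV'.mem_h hmem le_rfl hi.2
    · exact hV'.mem_v hmem le_rfl hi.1
  · rw [Finset.disjoint_left]
    intro e he
    simp only [inputs6V, Finset.mem_insert, Finset.mem_singleton] at he
    rcases he with rfl | rfl
    · rwa [h_mem_inputs6V]
    · rwa [v_mem_inputs6V]

/-- A vertex is added to a region of the twenty-vertex model. -/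
theorem configSum_insert_20V (ν q : ℂ) (z t w : ℕ → Spectral) (hp : (i, k) ∉ V)
    (hV' : Closed (insert (i, k) V)) (hV : Closed V) (hD' : ClosedDiagonal (insert (i, k) V))
    (hD : ClosedDiagonal V) :
    configSum inputs20V (vertexWeight20V ν q z t w) (insert (i, k) V) =
      R20V ν q z w (t (i + k - 1)) i k (i + k - 1)
        (configSum inputs20V (vertexWeight20V ν q z t w) V) := by
  have hmem := Finset.mem_insert_self (i, k) V
  have hU : V.biUnion inputs20V ∪ inputs20V (i, k) = (insert (i, k) V).biUnion inputs20V := by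
    rw [Finset.biUnion_insert, Finset.union_comm]
  have hi := hV'.one_le hmem
  have himage : (inputs20V (i, k)).image Edge.line = {.h i, .v k, .d (i + k - 1)} := rfl
  have hlt_h {b : ℕ} (h : (i, b) ∈ V) : b < k := by
    by_contra! hb
    exact hp (hV.mem_h h hi.2 hb)
  have hlt_v {a : ℕ} (h : (a, k) ∈ V) : a < i := by
    by_contra! ha
    exact hp (hV.mem_v h hi.1 ha)
  have hlt_d {a b : ℕ} (h : (a, b) ∈ V) (hab : a + b - 1 = i + k - 1) : a < i := by
    by_contra! ha
    have h1 := hV.one_le h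
    have h2 := hD h hi.1 ha
    rw [show a + b - i = k by omega] at h2
    exact hp h2
  funext s
  rw [configSum_insert (vertexWeight20V_congr ν q z t w) hp ?_ (injOn_line_inputs20V _), himage]
  · rw [R20V, tripleCrossing_apply, ← sum_powerset_triple (a := Edge.h i k) (b := Edge.v k i)
      (c := Edge.d (i + k - 1) i) (by simp) (by simp) (by simp)]
    refine Finset.sum_congr rfl fun X hX => ?_
    have hX' : X ⊆ inputs20V (i, k) := Finset.mem_powerset.1 hX
    have hh := line_mem_image_iff (injOn_line_inputs20V _) hX' (e := .h i k) (by simp [inputs20V])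
    have hv := line_mem_image_iff (injOn_line_inputs20V _) hX' (e := .v k i) (by simp [inputs20V])
    have hd := line_mem_image_iff (injOn_line_inputs20V _) hX' (e := .d (i + k - 1) i)
      (by simp [inputs20V])
    rw [ite_mem_triple_eq_update s (a := .h i) (b := .v k) (c := .d (i + k - 1)) (by simp)
      (by simp) (by simp) (decide_eq_decide.2 hh) (decide_eq_decide.2 hv) (decide_eq_decide.2 hd)]
    congr 1
    simp [vertexWeight20V, fill, inputs20V, Edge.line]
  · intro r hr e he hl
    obtain ⟨a, b⟩ := r
    have hab := hV.one_le hr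
    rw [himage] at hl
    rw [hU]
    simp only [around20V, Finset.mem_insert, Finset.mem_singleton] at he
    rcases he with rfl | rfl | rfl | rfl | rfl | rfl <;> simp [Edge.line] at hl <;>
      simp only [h_mem_inputs20V, v_mem_inputs20V, d_mem_inputs20V]
    · subst hl
      exact hV'.mem_h hmem (by omega) (hlt_h hr)
    · exact Finset.mem_insert_of_mem hr
    · exact ⟨b, Finset.mem_insert_of_mem hr, rfl⟩
    · exact Finset.mem_insert_of_mem hr
    · subst hl
      exact hV'.mem_v hmem (by omega) (hlt_v hr)
    · have := hlt_d hr hl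
      exact ⟨i + k - (a + 1), hD' hmem (by omega) this, by omega⟩
  · intro e he heV
    simp only [around20V, Finset.mem_insert, Finset.mem_singleton] at he
    rcases he with rfl | rfl | rfl | rfl | rfl | rfl <;>
      simp only [h_mem_inputs20V, v_mem_inputs20V, d_mem_inputs20V] at heV
    · exact absurd (hlt_h heV) (by omega)
    · simp [inputs20V]
    · simp [inputs20V]
    · simp [inputs20V]
    · exact absurd (hlt_v heV) (by omega)
    · obtain ⟨b, hb, hb'⟩ := heV
      exact absurd (hlt_d hb hb'.symm) (by omega)
  · intro e he hl
    rw [himage] at hl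
    rw [hU]
    rcases e with ⟨a, b⟩ | ⟨b, a⟩ | ⟨c, a⟩ <;> simp [Edge.line] at hl <;> subst hl <;>
      simp only [Edge.pos] at he <;> subst he <;>
      simp only [h_mem_inputs20V, v_mem_inputs20V, d_mem_inputs20V]
    · exact hV'.mem_h hmem le_rfl hi.2
    · exact hV'.mem_v hmem le_rfl hi.1
    · exact ⟨i + k - 1, hD' hmem le_rfl hi.1, by omega⟩
  · rw [Finset.disjoint_left]
    intro e he
    simp only [inputs20V, Finset.mem_insert, Finset.mem_singleton] at he
    rcases he with rfl | rfl | rfl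
    · rwa [h_mem_inputs20V]
    · rwa [v_mem_inputs20V]
    · rw [d_mem_inputs20V]
      rintro ⟨b, hb, hb'⟩
      exact absurd (hlt_d hb hb'.symm) (by omega)

/-! ### Building the triangle vertex by vertex. -/

theorem configSum_empty (inp : ℕ × ℕ → Finset Edge) (wt : ℕ × ℕ → (Edge → Bool) → ℂ)
    (R : ℕ → ℕ → ℕ → Op) : configSum inp wt ∅ = triangle R 0 := by
  funext s
  classical
  have hfill (e : Edge) : fill ∅ ∅ s e = s e.line := by simp [fill]
  -- Without vertices, the first edge of a line carries its exit state, so every line must be empty.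
  have h : (∀ e : Edge, e.pos = 1 → fill ∅ ∅ s e = false) ↔ ∀ l, s l = false := by
    simp only [hfill]
    refine ⟨fun h l => ?_, fun h e _ => h _⟩
    cases l with
    | h i => exact h (.h i 1) rfl
    | v k => exact h (.v k 1) rfl
    | d j => exact h (.d j 1) rfl
  rw [configSum, triangle, Finset.biUnion_empty, Finset.powerset_empty, Finset.sum_singleton,
    Finset.prod_empty]
  exact if_congr h rfl rfl

/-- The first `m` layers of the triangle and the first `r` vertices of the next one. -/
def partialTriangle (m r : ℕ) : Finset (ℕ × ℕ) :=
  (Finset.Icc 1 (m + 1) ×ˢ Finset.Icc 1 (m + 1)).filter fun p =>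
    p.1 + p.2 ≤ m + 1 ∨ p.1 + p.2 = m + 2 ∧ p.1 ≤ r

theorem mem_partialTriangle {m r a b : ℕ} : (a, b) ∈ partialTriangle m r ↔
    1 ≤ a ∧ 1 ≤ b ∧ (a + b ≤ m + 1 ∨ a + b = m + 2 ∧ a ≤ r) := by
  simp only [partialTriangle, Finset.mem_filter, Finset.mem_product, Finset.mem_Icc]
  omega

theorem mem_vertices20V {m a b : ℕ} : (a, b) ∈ vertices20V m ↔
    1 ≤ a ∧ 1 ≤ b ∧ a + b ≤ m + 1 := by
  simp only [vertices20V, Finset.mem_filter, Finset.mem_product, Finset.mem_Icc]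
  omega

theorem partialTriangle_zero (m : ℕ) : partialTriangle m 0 = vertices20V m := by
  ext ⟨a, b⟩
  rw [mem_partialTriangle, mem_vertices20V]
  omega

theorem partialTriangle_self (m : ℕ) : partialTriangle m (m + 1) = vertices20V (m + 1) := by
  ext ⟨a, b⟩
  rw [mem_partialTriangle, mem_vertices20V]
  omega

theorem partialTriangle_succ {m r : ℕ} (hr : r ≤ m) :
    partialTriangle m (r + 1) = insert (r + 1, m + 1 - r) (partialTriangle m r) := by
  ext ⟨a, b⟩
  rw [Finset.mem_insert, mem_partialTriangle, mem_partialTriangle, Prod.mk.injEq]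
  omega

theorem closed_partialTriangle (m r : ℕ) : Closed (partialTriangle m r) := by
  constructor <;> simp only [mem_partialTriangle] <;> omega

theorem closedDiagonal_partialTriangle (m r : ℕ) : ClosedDiagonal (partialTriangle m r) := by
  intro i k i'
  simp only [mem_partialTriangle]
  omega

theorem configSum_vertices20V {inp : ℕ × ℕ → Finset Edge} {wt : ℕ × ℕ → (Edge → Bool) → ℂ}
    {R : ℕ → ℕ → ℕ → Op}
    (h : ∀ m r, r ≤ m → configSum inp wt (partialTriangle m (r + 1)) =
      R (m + 1) (r + 1) (m + 1 - r) (configSum inp wt (partialTriangle m r))) (m : ℕ) :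
    configSum inp wt (vertices20V m) = triangle R m := by
  induction m with
  | zero => exact configSum_empty inp wt R
  | succ m ih =>
    rw [← partialTriangle_self, triangle, ← ih, ← partialTriangle_zero]
    suffices ∀ r ≤ m + 1, configSum inp wt (partialTriangle m r) =
        layer (R (m + 1)) (m + 1) r (configSum inp wt (partialTriangle m 0)) from this _ le_rfl
    intro r hr
    induction r with
    | zero => rfl
    | succ r ihr =>
      rw [h m r (by omega), ihr (by omega), layer, Module.End.mul_apply]

theorem configSum_vertices20V_eq_triangle6V (α q : ℂ) (z w : ℕ → Spectral) (m : ℕ) :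
    configSum inputs6V (vertexWeight6V α q z w) (vertices20V m) = triangle6V α q z w m := by
  refine configSum_vertices20V (fun m r hr => ?_) m
  have h := partialTriangle_succ hr
  rw [h]
  exact configSum_insert_6V α q z w (by rw [mem_partialTriangle]; omega)
    (h ▸ closed_partialTriangle _ _) (closed_partialTriangle _ _)

theorem configSum_vertices20V_eq_triangle (ν q : ℂ) (z t w : ℕ → Spectral) (m : ℕ) :
    configSum inputs20V (vertexWeight20V ν q z t w) (vertices20V m) =
      triangle (fun j i k => R20V ν q z w (t j) i k j) m := by
  refine configSum_vertices20V (fun m r hr => ?_) m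
  have h := partialTriangle_succ hr
  have hm : r + 1 + (m + 1 - r) - 1 = m + 1 := by omega
  rw [h, configSum_insert_20V ν q z t w (by rw [mem_partialTriangle]; omega)
    (h ▸ closed_partialTriangle _ _) (closed_partialTriangle _ _)
    (h ▸ closedDiagonal_partialTriangle _ _) (closedDiagonal_partialTriangle _ _), hm]

end

/-! ### Partition functions with domain wall boundary conditions -/

/-- The first `n` horizontal lines and the first `n` vertical lines carry a path step. -/
def domainWall (n : ℕ) : Line → Bool
  | .h i => decide (1 ≤ i ∧ i ≤ n)
  | .v k => decide (1 ≤ k ∧ k ≤ n)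
  | .d _ => false

/-- The configuration around a vertex is determined by the states of its two lines after the
crossing, if these are different. -/
theorem R₁_apply_of_ne (α q : ℂ) (z w : ℕ → Spectral) {i k : ℕ} (f : (Line → Bool) → ℂ)
    {s : Line → Bool} (h : s (.h i) ≠ s (.v k)) :
    R₁ α q z w i k f s = b₁ α q (z i) (w k) * f s := by
  rw [R₁, crossingWest, crossing_apply]
  -- The two states are those of the West and South edges. They coincide in all vertices of types
  -- `a` and `c`, so only a straight path is possible, and it does not change the states.
  rcases hh : s (.h i) with _ | _ <;> rcases hv : s (.v k) with _ | _
  · simp [hh, hv] at h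
  · simp [weight6V, update_eq_self_of hh, update_eq_self_of hv]
  · simp [weight6V, update_eq_self_of hh, update_eq_self_of hv]
  · simp [hh, hv] at h

theorem mem_vertices6V {n i k : ℕ} :
    (i, k) ∈ vertices6V n ↔ (1 ≤ i ∧ i ≤ n) ∧ 1 ≤ k ∧ k ≤ n := by
  simp [vertices6V]

/-- With domain wall boundary conditions, all vertices outside of the square are frozen. -/
theorem configSum_domainWall (α q : ℂ) (z w : ℕ → Spectral) {n : ℕ} {V : Finset (ℕ × ℕ)}
    (hV : Closed V) (hn : vertices6V n ⊆ V)
    (hs : ∀ i k, (i, k) ∈ V → (i, k) ∉ vertices6V n →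
      domainWall n (.h i) ≠ domainWall n (.v k)) :
    configSum inputs6V (vertexWeight6V α q z w) V (domainWall n) =
      (∏ p ∈ V \ vertices6V n, b₁ α q (z p.1) (w p.2)) *
        configSum inputs6V (vertexWeight6V α q z w) (vertices6V n) (domainWall n) := by
  induction hc : (V \ vertices6V n).card generalizing V with
  | zero =>
    have : V \ vertices6V n = ∅ := Finset.card_eq_zero.1 hc
    rw [this, Finset.prod_empty, one_mul, (Finset.sdiff_eq_empty_iff_subset.1 this).antisymm hn]
  | succ c ih =>
    have hne : (V \ vertices6V n).Nonempty := Finset.card_pos.1 (by omega)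
    -- A vertex outside the square with maximal `i + k` is an outer corner of `V`: anything weakly
    -- beyond it is also outside the square. Removing it keeps the region closed.
    obtain ⟨⟨i, k⟩, hp, hmax⟩ := Finset.exists_max_image _ (fun p : ℕ × ℕ => p.1 + p.2) hne
    obtain ⟨hpV, hpn⟩ := Finset.mem_sdiff.1 hp
    have hpos := hV.one_le hpV
    have hmax' {a b : ℕ} (h : (a, b) ∈ V) (ha : i ≤ a) (hb : k ≤ b) : a = i ∧ b = k := by
      have := hmax (a, b) (Finset.mem_sdiff.2 ⟨h, fun h' => hpn ?_⟩)
      · simp only at this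
        omega
      · rw [mem_vertices6V] at h' ⊢
        omega
    have hins : insert (i, k) (V.erase (i, k)) = V := Finset.insert_erase hpV
    have hclosed : Closed (V.erase (i, k)) := by
      constructor
      · exact fun h => hV.one_le (Finset.mem_of_mem_erase h)
      · intro a b b' h h1 hb
        refine Finset.mem_erase.2 ⟨fun h' => ?_, hV.mem_h (Finset.mem_of_mem_erase h) h1 hb⟩
        obtain ⟨rfl, rfl⟩ := Prod.mk.inj h'
        obtain ⟨-, rfl⟩ := hmax' (Finset.mem_of_mem_erase h) le_rfl hb
        exact Finset.notMem_erase _ _ h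
      · intro a b a' h h1 ha
        refine Finset.mem_erase.2 ⟨fun h' => ?_, hV.mem_v (Finset.mem_of_mem_erase h) h1 ha⟩
        obtain ⟨rfl, rfl⟩ := Prod.mk.inj h'
        obtain ⟨rfl, -⟩ := hmax' (Finset.mem_of_mem_erase h) ha le_rfl
        exact Finset.notMem_erase _ _ h
    have hn' : vertices6V n ⊆ V.erase (i, k) :=
      fun p h => Finset.mem_erase.2 ⟨fun h' => hpn (h' ▸ h), hn h⟩
    have hsd : V.erase (i, k) \ vertices6V n = (V \ vertices6V n).erase (i, k) :=
      Finset.erase_sdiff_comm _ _ _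
    rw [← Finset.mul_prod_erase _ _ hp, mul_assoc, ← hsd,
      ← ih hclosed hn' (fun a b h => hs a b (Finset.mem_of_mem_erase h))
        (by rw [hsd, Finset.card_erase_of_mem hp, hc, Nat.add_sub_cancel]),
      ← R₁_apply_of_ne α q z w _ (hs i k hpV hpn),
      ← configSum_insert_6V α q z w (Finset.notMem_erase _ _) (hins.symm ▸ hV) hclosed, hins]

/-! ### Identifying the partition functions with `configSum`. -/

theorem weight6V_eq_zero (a b c : ℂ) (x y x' y' : Bool)
    (h : x.toNat + y.toNat + (!x').toNat + (!y').toNat ≠ 2) : weight6V a b c x y x' y' = 0 := by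
  cases x <;> cases y <;> cases x' <;> cases y' <;> first | rfl | exact absurd rfl h

theorem weight20V_eq_zero (ν q : ℂ) (z t w : Spectral) (x y u x' y' u' : Bool)
    (h : x.toNat + y.toNat + u.toNat + (!x').toNat + (!y').toNat + (!u').toNat ≠ 3) :
    weight20V ν q z t w x y u x' y' u' = 0 := by
  cases x <;> cases y <;> cases u <;> cases x' <;> cases y' <;> cases u' <;>
    first | rfl | exact absurd rfl h

/-- Serves to drop the ice rule: the weights vanish where it fails. -/
theorem sum_filter_and_eq_sum_filter {ι : Type*} (s : Finset ι) (P Q : ι → Prop) [DecidablePred P]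
    [DecidablePred fun x => P x ∧ Q x] (F : ι → ℂ) (h : ∀ x, ¬ Q x → F x = 0) :
    ∑ x ∈ s with P x ∧ Q x, F x = ∑ x ∈ s with P x, F x := by
  refine Finset.sum_subset (Finset.monotone_filter_right s fun x _ hx => hx.1) fun x hx hx' => ?_
  rw [Finset.mem_filter] at hx hx'
  exact h x fun hQ => hx' ⟨hx.1, hx.2, hQ⟩

section

variable {n m i j k : ℕ}

theorem h_mem_edges6V : Edge.h i k ∈ edges6V n ↔ (1 ≤ i ∧ i ≤ n) ∧ 1 ≤ k ∧ k ≤ n + 1 := by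
  simp only [edges6V, Finset.mem_biUnion, Finset.mem_insert, Finset.mem_singleton, reduceCtorEq,
    Edge.h.injEq, false_or, or_false, Prod.exists, mem_vertices6V]
  constructor
  · rintro ⟨a, b, h, h' | h'⟩ <;> omega
  · intro h
    rcases Nat.lt_or_ge k (n + 1) with hk | hk
    · exact ⟨i, k, by omega, Or.inr (by omega)⟩
    · exact ⟨i, k - 1, by omega, Or.inl (by omega)⟩

theorem v_mem_edges6V : Edge.v k i ∈ edges6V n ↔ (1 ≤ k ∧ k ≤ n) ∧ 1 ≤ i ∧ i ≤ n + 1 := by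
  simp only [edges6V, Finset.mem_biUnion, Finset.mem_insert, Finset.mem_singleton, reduceCtorEq,
    Edge.v.injEq, false_or, Prod.exists, mem_vertices6V]
  constructor
  · rintro ⟨a, b, h, h' | h'⟩ <;> omega
  · intro h
    rcases Nat.lt_or_ge i (n + 1) with hi | hi
    · exact ⟨i, k, by omega, Or.inl (by omega)⟩
    · exact ⟨i - 1, k, by omega, Or.inr (by omega)⟩

theorem d_notMem_edges6V : Edge.d j i ∉ edges6V n := by
  simp [edges6V]

theorem h_mem_edges20V : Edge.h i k ∈ edges20V m ↔
    (1 ≤ i ∧ i ≤ m) ∧ 1 ≤ k ∧ i + k ≤ m + 2 := by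
  simp only [edges20V, Finset.mem_biUnion, Finset.mem_insert, Finset.mem_singleton, reduceCtorEq,
    Edge.h.injEq, false_or, or_false, Prod.exists, mem_vertices20V]
  constructor
  · rintro ⟨a, b, h, h' | h'⟩ <;> omega
  · intro h
    rcases Nat.lt_or_ge (i + k) (m + 2) with hk | hk
    · exact ⟨i, k, by omega, Or.inr (by omega)⟩
    · exact ⟨i, k - 1, by omega, Or.inl (by omega)⟩

theorem v_mem_edges20V : Edge.v k i ∈ edges20V m ↔
    (1 ≤ k ∧ k ≤ m) ∧ 1 ≤ i ∧ i + k ≤ m + 2 := by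
  simp only [edges20V, Finset.mem_biUnion, Finset.mem_insert, Finset.mem_singleton, reduceCtorEq,
    Edge.v.injEq, false_or, or_false, Prod.exists, mem_vertices20V]
  constructor
  · rintro ⟨a, b, h, h' | h'⟩ <;> omega
  · intro h
    rcases Nat.lt_or_ge (i + k) (m + 2) with hk | hk
    · exact ⟨i, k, by omega, Or.inl (by omega)⟩
    · exact ⟨i - 1, k, by omega, Or.inr (by omega)⟩

theorem d_mem_edges20V : Edge.d j i ∈ edges20V m ↔
    (1 ≤ j ∧ j ≤ m) ∧ 1 ≤ i ∧ i ≤ j + 1 := by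
  simp only [edges20V, Finset.mem_biUnion, Finset.mem_insert, Finset.mem_singleton, reduceCtorEq,
    Edge.d.injEq, false_or, Prod.exists, mem_vertices20V]
  constructor
  · rintro ⟨a, b, h, h' | h'⟩ <;> omega
  · intro h
    rcases Nat.lt_or_ge j i with hi | hi
    · exact ⟨i - 1, j + 2 - i, by omega, Or.inr (by omega)⟩
    · exact ⟨i, j + 1 - i, by omega, Or.inl (by omega)⟩

theorem d_mem_inputs_vertices20V : Edge.d j i ∈ (vertices20V m).biUnion inputs20V ↔
    1 ≤ i ∧ i ≤ j ∧ j ≤ m := by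
  simp only [d_mem_inputs20V, mem_vertices20V]
  exact ⟨fun ⟨k, h, h'⟩ => by omega, fun h => ⟨j + 1 - i, by omega, by omega⟩⟩

end

theorem DWBC_iff (n : ℕ) (S : Finset Edge) : DWBC n S ↔
    (∀ e ∈ edges6V n, e ∉ (vertices6V n).biUnion inputs6V →
      (e ∈ S ↔ domainWall n e.line = true)) ∧ ∀ e ∈ edges6V n, e.pos = 1 → e ∉ S := by
  constructor
  · refine fun h => ⟨fun e he heV => ?_, fun e he hpos => ?_⟩
    · rcases e with ⟨i, k⟩ | ⟨k, i⟩ | ⟨j, i⟩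
      · rw [h_mem_edges6V] at he
        rw [h_mem_inputs6V, mem_vertices6V] at heV
        obtain rfl : k = n + 1 := by omega
        simpa [domainWall, Edge.line, he.1] using h.west i (Finset.mem_Icc.2 he.1)
      · rw [v_mem_edges6V] at he
        rw [v_mem_inputs6V, mem_vertices6V] at heV
        obtain rfl : i = n + 1 := by omega
        simpa [domainWall, Edge.line, he.1] using h.south k (Finset.mem_Icc.2 he.1)
      · exact absurd he d_notMem_edges6V
    · rcases e with ⟨i, k⟩ | ⟨k, i⟩ | ⟨j, i⟩
      · obtain rfl : k = 1 := hpos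
        exact h.east i (Finset.mem_Icc.2 (h_mem_edges6V.1 he).1)
      · obtain rfl : i = 1 := hpos
        exact h.north k (Finset.mem_Icc.2 (v_mem_edges6V.1 he).1)
      · exact absurd he d_notMem_edges6V
  · rintro ⟨h, hpos⟩
    constructor <;> intro i hi <;> rw [Finset.mem_Icc] at hi
    · exact hpos _ (v_mem_edges6V.2 (by omega)) rfl
    · refine (h (.v i (n + 1)) (v_mem_edges6V.2 (by omega)) ?_).2 (decide_eq_true hi)
      rw [v_mem_inputs6V, mem_vertices6V]
      omega
    · exact hpos _ (h_mem_edges6V.2 (by omega)) rfl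
    · refine (h (.h i (n + 1)) (h_mem_edges6V.2 (by omega)) ?_).2 (decide_eq_true hi)
      rw [h_mem_inputs6V, mem_vertices6V]
      omega

/-- For both parities `i ≤ n` means `2 * i ≤ m + 1`, and `m + 1 - i ≤ n` means `m + 1 ≤ 2 * i`. Both
hold exactly at the central vertex, whose West and South edges both carry a path step. -/
theorem DWBC3_iff {m n : ℕ} (hm : m = 2 * n ∨ m + 1 = 2 * n) (S : Finset Edge) : DWBC3 m S ↔
    (∀ e ∈ edges20V m, e ∉ (vertices20V m).biUnion inputs20V →
      (e ∈ S ↔ domainWall n e.line = true)) ∧ ∀ e ∈ edges20V m, e.pos = 1 → e ∉ S := by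
  constructor
  · refine fun h => ⟨fun e he heV => ?_, fun e he hpos => ?_⟩
    · rcases e with ⟨i, k⟩ | ⟨k, i⟩ | ⟨j, i⟩
      · rw [h_mem_edges20V] at he
        rw [h_mem_inputs20V, mem_vertices20V] at heV
        obtain rfl : k = m + 2 - i := by omega
        have hi := Finset.mem_Icc.2 he.1
        simp only [Edge.line, domainWall, decide_eq_true_eq]
        rcases lt_trichotomy (2 * i) (m + 1) with h' | h' | h'
        · exact iff_of_true (h.diag_top i hi h').1 (by omega)
        · exact iff_of_true (h.diag_center i hi h').1 (by omega)
        · exact iff_of_false (h.diag_bottom i hi h').1 (by omega)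
      · rw [v_mem_edges20V] at he
        rw [v_mem_inputs20V, mem_vertices20V] at heV
        obtain ⟨i, rfl⟩ : ∃ i', i = i' + 1 := ⟨i - 1, by omega⟩
        obtain rfl : k = m + 1 - i := by omega
        have hi : i ∈ Finset.Icc 1 m := Finset.mem_Icc.2 (by omega)
        simp only [Edge.line, domainWall, decide_eq_true_eq]
        rcases lt_trichotomy (2 * i) (m + 1) with h' | h' | h'
        · exact iff_of_false (h.diag_top i hi h').2 (by omega)
        · exact iff_of_true (h.diag_center i hi h').2 (by omega)
        · exact iff_of_true (h.diag_bottom i hi h').2 (by omega)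
      · rw [d_mem_edges20V] at he
        rw [d_mem_inputs_vertices20V] at heV
        obtain rfl : i = j + 1 := by omega
        exact iff_of_false (h.east_d j (Finset.mem_Icc.2 he.1)) (by simp [Edge.line, domainWall])
    · rcases e with ⟨i, k⟩ | ⟨k, i⟩ | ⟨j, i⟩
      · obtain rfl : k = 1 := hpos
        exact h.east_h i (Finset.mem_Icc.2 (h_mem_edges20V.1 he).1)
      · obtain rfl : i = 1 := hpos
        exact h.north_v k (Finset.mem_Icc.2 (v_mem_edges20V.1 he).1)
      · obtain rfl : i = 1 := hpos
        exact h.north_d j (Finset.mem_Icc.2 (d_mem_edges20V.1 he).1)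
  · rintro ⟨h, hpos⟩
    have hh {i : ℕ} (hi : 1 ≤ i ∧ i ≤ m) : Edge.h i (m + 2 - i) ∈ S ↔ 1 ≤ i ∧ i ≤ n := by
      rw [h _ (h_mem_edges20V.2 (by omega)) (by rw [h_mem_inputs20V, mem_vertices20V]; omega)]
      exact decide_eq_true_iff
    have hv {i : ℕ} (hi : 1 ≤ i ∧ i ≤ m) :
        Edge.v (m + 1 - i) (i + 1) ∈ S ↔ 1 ≤ m + 1 - i ∧ m + 1 - i ≤ n := by
      rw [h _ (v_mem_edges20V.2 (by omega)) (by rw [v_mem_inputs20V, mem_vertices20V]; omega)]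
      exact decide_eq_true_iff
    constructor <;> intro i hi <;> rw [Finset.mem_Icc] at hi
    · exact hpos _ (v_mem_edges20V.2 (by omega)) rfl
    · exact hpos _ (d_mem_edges20V.2 (by omega)) rfl
    · exact hpos _ (h_mem_edges20V.2 (by omega)) rfl
    · rw [h _ (d_mem_edges20V.2 (by omega)) (by rw [d_mem_inputs_vertices20V]; omega)]
      simp [Edge.line, domainWall]
    all_goals
      intro h'
      rw [hh hi, hv hi]
      omega

theorem Z6V₁_eq_configSum (α q : ℂ) (n : ℕ) (z w : ℕ → Spectral) :
    Z6V₁ α q n z w =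
      configSum inputs6V (vertexWeight6V α q z w) (vertices6V n) (domainWall n) := by
  classical
  rw [← sum_filter_eq_configSum (adj := around6V) (E := edges6V n) (bdry := DWBC n)
    (vertexWeight6V_congr α q z w)]
  · rw [Z6V₁, configs6V, sum_filter_and_eq_sum_filter]
    · exact Finset.sum_congr (Finset.filter_congr_decidable _ _ _) fun S _ => rfl
    · intro S hS
      push Not at hS
      obtain ⟨p, hp, hice⟩ := hS
      exact Finset.prod_eq_zero hp (weight6V_eq_zero _ _ _ _ _ _ _ hice)
  · refine Finset.biUnion_mono fun p _ e he => ?_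
    simp only [inputs6V, Finset.mem_insert, Finset.mem_singleton] at he ⊢
    tauto
  · exact fun p hp => Finset.subset_biUnion_of_mem around6V hp
  · exact fun S _ => DWBC_iff n S
  · intro e hpos he
    rcases e with ⟨i, k⟩ | ⟨k, i⟩ | ⟨j, i⟩
    · obtain rfl : k = 1 := hpos
      rw [h_mem_edges6V] at he
      exact decide_eq_false (by omega)
    · obtain rfl : i = 1 := hpos
      rw [v_mem_edges6V] at he
      exact decide_eq_false (by omega)
    · rfl

theorem Z20V₃_eq_configSum (ν q : ℂ) {m n : ℕ} (hm : m = 2 * n ∨ m + 1 = 2 * n)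
    (z t w : ℕ → Spectral) :
    Z20V₃ ν q m z t w =
      configSum inputs20V (vertexWeight20V ν q z t w) (vertices20V m) (domainWall n) := by
  classical
  rw [← sum_filter_eq_configSum (adj := around20V) (E := edges20V m) (bdry := DWBC3 m)
    (vertexWeight20V_congr ν q z t w)]
  · rw [Z20V₃, configs20V₃, sum_filter_and_eq_sum_filter]
    · exact Finset.sum_congr (Finset.filter_congr_decidable _ _ _) fun S _ => rfl
    · intro S hS
      push Not at hS
      obtain ⟨p, hp, hice⟩ := hS
      exact Finset.prod_eq_zero hp (weight20V_eq_zero _ _ _ _ _ _ _ _ _ _ _ hice)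
  · refine Finset.biUnion_mono fun p _ e he => ?_
    simp only [inputs20V, Finset.mem_insert, Finset.mem_singleton] at he ⊢
    tauto
  · exact fun p hp => Finset.subset_biUnion_of_mem around20V hp
  · exact fun S _ => DWBC3_iff hm S
  · intro e hpos he
    rcases e with ⟨i, k⟩ | ⟨k, i⟩ | ⟨j, i⟩
    · obtain rfl : k = 1 := hpos
      rw [h_mem_edges20V] at he
      exact decide_eq_false (by omega)
    · obtain rfl : i = 1 := hpos
      rw [v_mem_edges20V] at he
      exact decide_eq_false (by omega)
    · rfl

/-! ### Assembling the product formula. -/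

theorem prod_diagonalWeight (α₂ α₃ q : ℂ) (z t w : ℕ → Spectral) (m : ℕ) :
    ∏ j ∈ Finset.Icc 1 m, diagonalWeight α₂ α₃ q z w (t j) j =
      (∏ p ∈ Finset.Icc 1 m ×ˢ Finset.Icc 1 m with p.1 ≤ p.2, a₂ α₂ q (z p.1) (t p.2)) *
        ∏ p ∈ Finset.Icc 1 m ×ˢ Finset.Icc 1 m with p.2 ≤ p.1, a₃ α₃ q (t p.1) (w p.2) := by
  have h {j : ℕ} (hj : j ∈ Finset.Icc 1 m) :
      (Finset.Icc 1 m).filter (fun i => i ≤ j) = Finset.Icc 1 j := by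
    ext i
    simp only [Finset.mem_filter, Finset.mem_Icc] at hj ⊢
    omega
  simp only [diagonalWeight, Finset.prod_mul_distrib]
  rw [Finset.prod_filter, Finset.prod_filter, Finset.prod_product_right, Finset.prod_product]
  congr 1 <;> refine Finset.prod_congr rfl fun j hj => ?_ <;> rw [← Finset.prod_filter, h hj]

/-- The partition function of the twenty-vertex model on the triangle of size `m`, where `n` is
half of `m`, rounded up. -/
theorem Z20V₃_eq (α₁ α₂ α₃ q : ℂ) (hq : q ≠ 0) (z t w : ℕ → Spectral) {m n : ℕ}
    (hm : m = 2 * n ∨ m + 1 = 2 * n) :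
    Z20V₃ (α₁ * α₂ * α₃) q m z t w =
      (∏ p ∈ Finset.Icc 1 m ×ˢ Finset.Icc 1 m with p.1 ≤ p.2, a₂ α₂ q (z p.1) (t p.2)) *
        (∏ p ∈ Finset.Icc 1 m ×ˢ Finset.Icc 1 m with p.2 ≤ p.1, a₃ α₃ q (t p.1) (w p.2)) *
        (∏ p ∈ vertices20V m \ vertices6V n, b₁ α₁ q (z p.1) (w p.2)) * Z6V₁ α₁ q n z w := by
  have hdiag : ∀ l ∈ diagonalLines m, domainWall n l = false := by
    rintro _ ⟨j, -, rfl⟩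
    rfl
  rw [Z20V₃_eq_configSum _ q hm, configSum_vertices20V_eq_triangle,
    agreeOn_triangle_R20V α₁ α₂ α₃ hq t m _ hdiag, Pi.smul_apply, smul_eq_mul,
    prod_diagonalWeight, ← configSum_vertices20V_eq_triangle6V, configSum_domainWall (n := n),
    ← Z6V₁_eq_configSum, mul_assoc _ (∏ p ∈ _ \ _, _)]
  · rw [← partialTriangle_zero]
    exact closed_partialTriangle m 0
  · rintro ⟨i, k⟩ h
    rw [mem_vertices6V] at h
    rw [mem_vertices20V]
    omega
  -- Since `i + k ≤ m + 1 ≤ 2 * n + 1`, outside the square exactly one of `i` and `k` exceeds `n`.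
  · intro i k h h'
    rw [mem_vertices20V] at h
    rw [mem_vertices6V] at h'
    simp only [domainWall, ne_eq, decide_eq_decide]
    omega

end TwentyVertex

open TwentyVertex
theorem mainTheorem1 (α₁ α₂ α₃ q : ℂ) (hq : q ≠ 0) (z t w : ℕ → Spectral)
    (n : ℕ) (hn : 1 ≤ n) :
    Z20V₃ (α₁ * α₂ * α₃) q (2 * n) z t w =
        (∏ p ∈ Finset.Icc 1 (2 * n) ×ˢ Finset.Icc 1 (2 * n) with p.1 ≤ p.2,
            a₂ α₂ q (z p.1) (t p.2)) *
          (∏ p ∈ Finset.Icc 1 (2 * n) ×ˢ Finset.Icc 1 (2 * n) with p.2 ≤ p.1,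
            a₃ α₃ q (t p.1) (w p.2)) *
          (∏ p ∈ Finset.Icc 1 (2 * n) ×ˢ Finset.Icc 1 (2 * n) with
              (p.1 ≤ 2 * n + 1 - p.2 ∧ 2 * n + 1 - p.2 ≤ n) ∨
                (n + 1 ≤ p.1 ∧ p.1 ≤ 2 * n + 1 - p.2),
            b₁ α₁ q (z p.1) (w p.2)) *
          Z6V₁ α₁ q n z w ∧
      Z20V₃ (α₁ * α₂ * α₃) q (2 * n - 1) z t w =
        (∏ p ∈ Finset.Icc 1 (2 * n - 1) ×ˢ Finset.Icc 1 (2 * n - 1) with p.1 ≤ p.2,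
            a₂ α₂ q (z p.1) (t p.2)) *
          (∏ p ∈ Finset.Icc 1 (2 * n - 1) ×ˢ Finset.Icc 1 (2 * n - 1) with p.2 ≤ p.1,
            a₃ α₃ q (t p.1) (w p.2)) *
          (∏ p ∈ Finset.Icc 1 (2 * n - 1) ×ˢ Finset.Icc 1 (2 * n - 1) with
              (p.1 ≤ 2 * n - p.2 ∧ 2 * n - p.2 ≤ n - 1) ∨
                (n + 1 ≤ p.1 ∧ p.1 ≤ 2 * n - p.2),
            b₁ α₁ q (z p.1) (w p.2)) *
          Z6V₁ α₁ q n z w := by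
  constructor
  · rw [Z20V₃_eq α₁ α₂ α₃ q hq z t w (Or.inl rfl)]
    congr 2
    refine Finset.prod_congr ?_ fun _ _ => rfl
    -- The triangle minus the square consists of two smaller triangles, one with `n + 1 ≤ k` and one
    -- with `n + 1 ≤ i`.
    ext ⟨i, k⟩
    rw [Finset.mem_sdiff, mem_vertices20V, mem_vertices6V, Finset.mem_filter, Finset.mem_product,
      Finset.mem_Icc, Finset.mem_Icc]
    omega
  · have hm : 2 * n - 1 + 1 = 2 * n := by omega
    rw [Z20V₃_eq α₁ α₂ α₃ q hq z t w (Or.inr hm)]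
    congr 2
    refine Finset.prod_congr ?_ fun _ _ => rfl
    ext ⟨i, k⟩
    rw [Finset.mem_sdiff, mem_vertices20V, mem_vertices6V, Finset.mem_filter, Finset.mem_product,
      Finset.mem_Icc, Finset.mem_Icc]
    omega
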